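/- Let $d\ge 1$, let $S_t=S_0+\xi_1+\dots+\xi_t$ ($t\ge 0$) be a random walk on $\mathbb Z^d$, write $x[1]$ for the first coordinate of $x\in\mathbb Z^d$ and $\mathbb Z^d_{0+}=\{x: x[1]\ge 0\}$, and let $\{H(x)\}_{x\in\mathbb Z^d}$ be random variables with values in $\{0,1,2,\dots\}\cup\{\infty\}$. Put $L_t(x)=\#\{0\le j\le t: S_j=x\}$, $T_*=\inf\{t\ge0: L_t(S_t)>H(S_t)\}$, $\alpha(n)=\inf\{t\ge 0: S_t[1]\ge n\}$ and $B_n=\{\alpha(n)<T_*\}$ (with $\inf\emptyset=\infty$). A number $k\in\{0,\dots,n\}$ is an $n$-separating level if $\alpha(n)<\infty$ and $$\sup_{0\le t<\alpha(k)}S_t[1]<k=S_{\alpha(k)}[1]\le\inf_{\alpha(k)<t<\alpha(n)}S_t[1].$$ On $B_n$ let $\eta_*(n)+1$ be the number of $n$-separating levels, and off $B_n$ let $\eta_*(n)=-1$. If $\eta_*(n)\ge1$, let $\varkappa_*(n)$ be the largest $n$-separating level $k<n$; otherwise let $\varkappa_*(n)=-\infty$. Write $\mathbf P_*$ for the probability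 in this model and $\mathbf P_0$ for the probability when $S_0=0$ and $H(y)=0$ for all $y\notin\mathbb Z^d_{0+}$ (the $\xi_i$ and the $H(x)$, $x\in\mathbb Z^d_{0+}$, being unchanged). Assume: (A1) $\xi_1,\xi_2,\dots$ are i.i.d. in $\mathbb Z^d$, $\xi_1[1]\le 1$ a.s. and $\mathbf P(\xi_1[1]=1)>0$. (A2) The families $\{S_0;\,H(x),x\notin\mathbb Z^d_{0+}\}$, $\{\xi_i,i\ge1\}$ and $\{H(x),x\in\mathbb Z^d_{0+}\}$ are mutually independent, $S_0[1]\le 0$ a.s., and $\mathbf P_*(B_0)>0$. (A3) The variables $H(x)$, $x\in\mathbb Z^d_{0+}$, are i.i.d. and $\mathbf P(1\le H(0)\le\infty)=1$. (A4) With $\beta_0=\inf\{t>0:\xi_1[1]+\dots+\xi_t[1]=0\}$ and $\beta_{0,0}=\inf\{t>0:\xi_1+\dots+\xi_t=0\}$: if $\mathbf P(\beta_0<\infty)=1$, then $\mathbf P(\beta_{0,0}<\infty)>0$; and if $\mathbf P(\beta_0=\beta_{0,0}<\infty)=1$, then $\mathbf E H(0)<\infty$. (A5) If $\mathbf P(\beta_0<\infty)=1$,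 then $\mathbf P(H(0)<\infty)>0$. Then there is a number $q\in(0,1]$ such that $$\sum_{k=1}^\infty \frac{\mathbf P_0(\varkappa_*(k)=0)}{q^k}=1,\qquad 1\le\mu:=\sum_{k=1}^\infty \frac{k\,\mathbf P_0(\varkappa_*(k)=0)}{q^k}<\infty,\qquad 0<\psi_0:=\sum_{m=0}^\infty\frac{\mathbf P_*(\eta_*(m)=0)}{q^m}<\infty.$$ -/

import Mathlib

open MeasureTheory ProbabilityTheory
open scoped ENNReal

noncomputable section

namespace LocalConstraints

/-- The first time `t ≥ 0` at which `p t` holds, with `inf ∅ = ∞`. -/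
def firstTime (p : ℕ → Prop) : ℕ∞ := ⨅ (t : ℕ) (_ : p t), (t : ℕ∞)

/-- The lattice `ℤ^d`; the first coordinate ("height") of `x` is `x 0`. -/
abbrev Lattice (d : ℕ) : Type := Fin d → ℤ

section Paths

variable {d : ℕ} [NeZero d]

/-- `α(n | y) = inf {t ≥ 0 : y_t[1] ≥ n}`. -/
def hit (n : ℕ) (y : ℕ → Lattice d) : ℕ∞ := firstTime fun t => (n : ℤ) ≤ y t 0

/-- The local time `L_t(x) = #{0 ≤ j ≤ t : y_j = x}`. -/
def localTime (y : ℕ → Lattice d) (t : ℕ) (x : Lattice d) : ℕ :=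
  ((Finset.range (t + 1)).filter fun j => y j = x).card

/-- The killing time `T_* = inf {t ≥ 0 : L_t(y_t) > h(y_t)}` in the environment `h`. -/
def killTime (y : ℕ → Lattice d) (h : Lattice d → ℕ∞) : ℕ∞ :=
  firstTime fun t => h (y t) < (localTime y t (y t) : ℕ∞)

/-- The event `B_n = {α(n) < T_*}`. -/
def Reaches (n : ℕ) (y : ℕ → Lattice d) (h : Lattice d → ℕ∞) : Prop :=
  hit n y < killTime y h

/-- `k ∈ {0, …, n}` is an `n`-separating level of the path `y`: `α(n) < ∞` and
`sup_{t < α(k)} y_t[1] < k = y_{α(k)}[1] ≤ inf_{α(k) < t < α(n)} y_t[1]`. -/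
def IsSeparating (n : ℕ) (y : ℕ → Lattice d) (k : ℕ) : Prop :=
  k ≤ n ∧ hit n y < ⊤ ∧
    (∀ t : ℕ, (t : ℕ∞) < hit k y → y t 0 < (k : ℤ)) ∧
    y (hit k y).toNat 0 = (k : ℤ) ∧
    ∀ t : ℕ, hit k y < (t : ℕ∞) → (t : ℕ∞) < hit n y → (k : ℤ) ≤ y t 0

open Classical in
/-- `η(n | y)`: the number of `n`-separating levels, minus one. -/
def eta (n : ℕ) (y : ℕ → Lattice d) : ℤ :=
  (((Finset.range (n + 1)).filter (IsSeparating n y)).card : ℤ) - 1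

open Classical in
/-- `ϰ(n | y)`: the largest `n`-separating level `k < n`, and `-∞` (that is `⊥`) if there is none. -/
def kappa (n : ℕ) (y : ℕ → Lattice d) : WithBot ℕ :=
  ((Finset.range n).filter (IsSeparating n y)).max

open Classical in
/-- `η_*(n)`, equal to `η(n | y)` if `α(n) < T_*` and to `-1` otherwise. -/
def etaStar (n : ℕ) (y : ℕ → Lattice d) (h : Lattice d → ℕ∞) : ℤ :=
  if Reaches n y h then eta n y else -1

open Classical in
/-- `ϰ_*(n)`, equal to `ϰ(n | y)` if `η_*(n) ≥ 1` and to `-∞` otherwise. -/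
def kappaStar (n : ℕ) (y : ℕ → Lattice d) (h : Lattice d → ℕ∞) : WithBot ℕ :=
  if 1 ≤ etaStar n y h then kappa n y else ⊥

/-- The environment which agrees with `h` on the half-space `x[1] ≥ 0` and vanishes off it. -/
def zeroBelow (h : Lattice d → ℕ∞) (x : Lattice d) : ℕ∞ := if 0 ≤ x 0 then h x else 0

/-- The path `y_t = s + ξ_1 + ⋯ + ξ_t`; the increment `ξ_{j+1}` is written `ξ j`. -/
def walk (s : Lattice d) (ξ : ℕ → Lattice d) (t : ℕ) : Lattice d :=
  s + ∑ j ∈ Finset.range t, ξ j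

/-- `β_0 = inf {t > 0 : ξ_1[1] + ⋯ + ξ_t[1] = 0}`. -/
def returnLevel (ξ : ℕ → Lattice d) : ℕ∞ := firstTime fun t => 0 < t ∧ walk 0 ξ t 0 = 0

/-- `β_{0,0} = inf {t > 0 : ξ_1 + ⋯ + ξ_t = 0}`. -/
def returnOrigin (ξ : ℕ → Lattice d) : ℕ∞ := firstTime fun t => 0 < t ∧ walk 0 ξ t = 0

end Paths

section Model

variable {d : ℕ} [NeZero d] {Ω : Type*} [MeasurableSpace Ω]

/-- (A1): i.i.d. increments whose first coordinate is skip-free to the right. -/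
structure A1 (P : Measure Ω) (ξ : ℕ → Ω → Lattice d) : Prop where
  measurable : ∀ j, Measurable (ξ j)
  indep : iIndepFun ξ P
  ident : ∀ j, IdentDistrib (ξ j) (ξ 0) P P
  skipFree : ∀ᵐ ω ∂P, ξ 0 ω 0 ≤ 1
  up : 0 < P {ω | ξ 0 ω 0 = 1}

/-- (A2): the families `{S_0; H(x), x[1] < 0}`, `{ξ_i}` and `{H(x), x[1] ≥ 0}` are mutually
independent, `S_0[1] ≤ 0` a.s., and `P(B_0) > 0`. -/
structure A2 (P : Measure Ω) (S₀ : Ω → Lattice d) (ξ : ℕ → Ω → Lattice d)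
    (H : Lattice d → Ω → ℕ∞) : Prop where
  measurable_start : Measurable S₀
  measurable_env : ∀ x, Measurable (H x)
  indep : iIndep
    (![MeasurableSpace.comap S₀ inferInstance ⊔
          ⨆ x : {x : Lattice d // x 0 < 0}, MeasurableSpace.comap (H x) inferInstance,
        ⨆ j : ℕ, MeasurableSpace.comap (ξ j) inferInstance,
        ⨆ x : {x : Lattice d // 0 ≤ x 0}, MeasurableSpace.comap (H x) inferInstance] :
      Fin 3 → MeasurableSpace Ω) P
  start : ∀ᵐ ω ∂P, S₀ ω 0 ≤ 0
  reach : 0 < P {ω | Reaches 0 (walk (S₀ ω) fun j => ξ j ω) fun x => H x ω}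

/-- (A3): the constraints in the half-space `x[1] ≥ 0` are i.i.d. with values in `[1, ∞]`. -/
structure A3 (P : Measure Ω) (H : Lattice d → Ω → ℕ∞) : Prop where
  indep : iIndepFun (fun (x : {x : Lattice d // 0 ≤ x 0}) => H x) P
  ident : ∀ x : Lattice d, 0 ≤ x 0 → IdentDistrib (H x) (H 0) P P
  one_le : ∀ᵐ ω ∂P, 1 ≤ H 0 ω

/-- (A4): if `β_0 < ∞` a.s. then `P(β_{0,0} < ∞) > 0`; if `β_0 = β_{0,0} < ∞` a.s. then
`E H(0) < ∞`. -/
structure A4 (P : Measure Ω) (ξ : ℕ → Ω → Lattice d) (H : Lattice d → Ω → ℕ∞) : Prop where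
  return_origin : P {ω | returnLevel (fun j => ξ j ω) < ⊤} = 1 →
    0 < P {ω | returnOrigin (fun j => ξ j ω) < ⊤}
  finite_mean : P {ω | returnLevel (fun j => ξ j ω) = returnOrigin (fun j => ξ j ω) ∧
      returnOrigin (fun j => ξ j ω) < ⊤} = 1 →
    ∫⁻ ω, (H 0 ω : ℝ≥0∞) ∂P < ⊤
/-- `P_*(η_*(n) = 0)`. -/
def probEtaZero (P : Measure Ω) (S₀ : Ω → Lattice d) (ξ : ℕ → Ω → Lattice d)
    (H : Lattice d → Ω → ℕ∞) (n : ℕ) : ℝ :=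
  P.real {ω | etaStar n (walk (S₀ ω) fun j => ξ j ω) (fun x => H x ω) = 0}

/-- `P_0(ϰ_*(n) = 0)`, where under `P_0` the walk starts from `0` and `H(x) = 0` whenever
`x[1] < 0`. By the independence in (A2) conditioning on these values of `S_0` and of
`(H(x))_{x[1] < 0}` amounts to substituting them. -/
def probKappaZero (P : Measure Ω) (ξ : ℕ → Ω → Lattice d) (H : Lattice d → Ω → ℕ∞)
    (n : ℕ) : ℝ :=
  P.real {ω | kappaStar n (walk 0 fun j => ξ j ω) (zeroBelow fun x => H x ω) = (0 : ℕ)}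

end Model

end LocalConstraints

end

/-! Write u_n for `climb n`, f_k for `step k`, which is P_0(ϰ_*(k) = 0) when k ≥ 1
(`probKappaZero_eq`), and N for `levelGreen` at the origin, the expected number of visits to level 0
when only the constraints on that level count.

Pieces of a path below and above a separating level use the constraints of disjoint sets of sites.
Cutting at the lowest positive separating level therefore gives the renewal equation u_n = Σ f_k
u_{n-k} for n ≥ 1 (`climb_succ`), and with it u_a u_b ≤ u_{a+b}. In the other direction u_{a+b} ≤ N
u_a u_b: cut at the first passage to level a (`climb_add_le`), then cut the remainder at its last
visit to the level where it starts (`total_firstPassage_le`). If N is finite, the two inequalities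
yield a rate q, the supremum of u_n^{1/n}, with u_n ≤ q^n ≤ N u_n (`exists_geometric_rate`). Then
u_n / q^n is a renewal sequence with values in [1/N, 1] and weights f_k / q^k; a renewal sequence
bounded away from 0 forces total mass 1 and finite mean (`hasSum_of_renewal`). Cutting paths at
their lowest separating level gives Σ_{m ≤ n} P_*(η_*(m) = 0) u_{n-m} ≤ N u_n, so the partial sums
of ψ_0 are at most N²; its term m = 0 is positive by (A2).

The main work is N < ∞ (`tsum_expect_allow_ne_top`). The visits to level 0 form an induced random
walk on that level whose steps are excursions. If its step law has mass below 1, a geometric series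
suffices. If it never leaves the origin, N is at most the sum of the tails of H(0), finite by (A4).
Otherwise it has two different possible steps and a possible loop. It then escapes any set of K
sites in about K² steps with probability at least 1/2 (`exists_expect_indicator_le`), and next to
run the loop until one more site has been visited more than h times. Within about K³ steps the
chance of respecting the constraints is thus exponentially small in K, up to a polynomial factor,
which is summable.

Finite paths are lists of steps, and all probabilities are sums over lists in [0, ∞], so every
decomposition becomes an injective relation between lists (`tsum_le_tsum_of_rel`). -/

noncomputable section

namespace LocalConstraints

/-! ### Comparison of sums over paths -/

section Sums

/-- Comparison of two sums along a relation that is injective on the support. -/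
theorem tsum_le_tsum_of_rel {α β : Type*} {f : α → ℝ≥0∞} {g : β → ℝ≥0∞} (R : α → β → Prop)
    (h : ∀ a, f a ≠ 0 → ∃ b, R a b ∧ f a ≤ g b)
    (hR : ∀ a a' b, f a ≠ 0 → f a' ≠ 0 → R a b → R a' b → a = a') :
    ∑' a, f a ≤ ∑' b, g b := by
  choose i hi using fun a : Function.support f => h a a.2
  have inj : Function.Injective i := by
    intro a a' haa
    exact Subtype.ext (hR a a' (i a) a.2 a'.2 (hi a).1 (haa ▸ (hi a').1))
  calc ∑' a, f a = ∑' a : Function.support f, f a := (tsum_subtype_support f).symm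
    _ ≤ ∑' a : Function.support f, g (i a) := ENNReal.tsum_le_tsum fun a => (hi a).2
    _ ≤ ∑' b, g b := ENNReal.tsum_comp_le_tsum_of_injective inj g

theorem tsum_mul_tsum {α β : Type*} (f : α → ℝ≥0∞) (g : β → ℝ≥0∞) :
    (∑' a, f a) * ∑' b, g b = ∑' x : α × β, f x.1 * g x.2 := by
  rw [ENNReal.tsum_prod (f := fun a b => f a * g b)]
  simp only [ENNReal.tsum_mul_left, ENNReal.tsum_mul_right]

end Sums

variable {d : ℕ}

/-- The sites visited by the path with steps `l` started at `s`, its last position excluded. -/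
def sites : Lattice d → List (Lattice d) → List (Lattice d)
  | _, [] => []
  | s, a :: l => s :: sites (s + a) l

@[simp] theorem sites_nil (s : Lattice d) : sites s [] = [] := rfl

@[simp] theorem sites_cons (s a : Lattice d) (l : List (Lattice d)) :
    sites s (a :: l) = s :: sites (s + a) l := rfl

theorem sites_append (s : Lattice d) (l l' : List (Lattice d)) :
    sites s (l ++ l') = sites s l ++ sites (s + l.sum) l' := by
  induction l generalizing s with
  | nil => simp
  | cons a l ih => simp [ih, add_assoc]

theorem sites_add (s c : Lattice d) (l : List (Lattice d)) :
    sites (s + c) l = (sites s l).map (· + c) := by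
  induction l generalizing s with
  | nil => simp
  | cons a l ih => simp [← ih, add_right_comm]

theorem mem_sites_add {s c x : Lattice d} {l : List (Lattice d)} :
    x ∈ sites (s + c) l ↔ x - c ∈ sites s l := by
  rw [sites_add, List.mem_map]
  constructor
  · rintro ⟨y, hy, rfl⟩
    simpa using hy
  · intro h
    exact ⟨_, h, by simp⟩

theorem mem_sites_zero {c x : Lattice d} {l : List (Lattice d)} :
    x ∈ sites c l ↔ x - c ∈ sites 0 l := by
  simpa using mem_sites_add (s := 0) (c := c) (x := x) (l := l)

/-- The start of a nonempty proper segment is one of its sites. -/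
theorem mem_sites_prefix {s : Lattice d} {l c : List (Lattice d)} (hc : c ≠ []) :
    s + l.sum ∈ sites s (l ++ c) := by
  cases c with
  | nil => exact absurd rfl hc
  | cons a c => rw [sites_append]; simp

/-! ### Weights of visits and of steps -/

section Weights

/-- The probability that independent constraints with tail function `G` allow the visits `M`. -/
def allow (G : ℕ → ℝ≥0∞) (M : List (Lattice d)) : ℝ≥0∞ :=
  ∏ x ∈ M.toFinset, G (M.count x)

variable {G : ℕ → ℝ≥0∞}

@[simp] theorem allow_nil : allow G ([] : List (Lattice d)) = 1 := by simp [allow]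

theorem allow_eq_prod (h0 : G 0 = 1) {M : List (Lattice d)} {T : Finset (Lattice d)}
    (hT : M.toFinset ⊆ T) : allow G M = ∏ x ∈ T, G (M.count x) := by
  refine Finset.prod_subset hT fun x _ hx => ?_
  rw [List.count_eq_zero_of_not_mem (by simpa using hx), h0]

theorem allow_anti (h0 : G 0 = 1) (hG : Antitone G) {M M' : List (Lattice d)}
    (h : ∀ x, M.count x ≤ M'.count x) : allow G M' ≤ allow G M := by
  have hsub : M.toFinset ⊆ M'.toFinset := by
    intro x hx
    rw [List.mem_toFinset, ← List.count_pos_iff] at hx ⊢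
    exact hx.trans_le (h x)
  rw [allow_eq_prod h0 hsub]
  exact Finset.prod_le_prod' fun x _ => hG (h x)

theorem allow_le_one (h0 : G 0 = 1) (hG : Antitone G) (M : List (Lattice d)) :
    allow G M ≤ 1 := by
  simpa using allow_anti h0 hG (M := []) (M' := M) (by simp)

theorem allow_append {M M' : List (Lattice d)} (h : ∀ x ∈ M, x ∉ M') :
    allow G (M ++ M') = allow G M * allow G M' := by
  have hd : Disjoint M.toFinset M'.toFinset := by
    rw [Finset.disjoint_left]; simpa using h
  rw [allow, List.toFinset_append, Finset.prod_union hd]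
  congr 1
  · refine Finset.prod_congr rfl fun x hx => ?_
    rw [List.count_append, List.count_eq_zero_of_not_mem (h x (by simpa using hx)), add_zero]
  · refine Finset.prod_congr rfl fun x hx => ?_
    rw [List.count_append, List.count_eq_zero_of_not_mem (l := M), zero_add]
    intro hxM
    exact h x hxM (by simpa using hx)

/-- A site visited only once carries the factor G 1 = 1. This is where the bound H ≥ 1 enters: a cut
point may be counted or left out at no cost. -/
theorem allow_cons (h1 : G 1 = 1) {x : Lattice d} {M : List (Lattice d)}
    (h : x ∉ M) : allow G (x :: M) = allow G M := by
  have := allow_append (G := G) (M := [x]) (M' := M) (by simpa using h)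
  simpa [allow, h1] using this

theorem allow_map_add (M : List (Lattice d)) (c : Lattice d) :
    allow G (M.map (· + c)) = allow G M := by
  have hinj : Function.Injective (fun x : Lattice d => x + c) := add_left_injective c
  have : (M.map (· + c)).toFinset = M.toFinset.image (· + c) := by
    ext x; simp only [List.mem_toFinset, List.mem_map, Finset.mem_image]
  rw [allow, this, Finset.prod_image (fun x _ y _ h => hinj h)]
  refine Finset.prod_congr rfl fun x _ => ?_
  rw [List.count_map_of_injective _ _ hinj]

theorem allow_sites (s : Lattice d) (l : List (Lattice d)) :
    allow G (sites s l) = allow G (sites 0 l) := by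
  have := sites_add 0 s l
  rw [zero_add] at this
  rw [this, allow_map_add]

/-- The product of the probabilities of the steps of a path. -/
def pathProb (p : Lattice d → ℝ≥0∞) (l : List (Lattice d)) : ℝ≥0∞ := (l.map p).prod

variable {p : Lattice d → ℝ≥0∞}

@[simp] theorem pathProb_nil : pathProb p [] = 1 := by simp [pathProb]

@[simp] theorem pathProb_cons (a : Lattice d) (l : List (Lattice d)) :
    pathProb p (a :: l) = p a * pathProb p l := by simp [pathProb]

theorem pathProb_append (l l' : List (Lattice d)) :
    pathProb p (l ++ l') = pathProb p l * pathProb p l' := by simp [pathProb]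

theorem apply_ne_zero_of_pathProb {l : List (Lattice d)} (h : pathProb p l ≠ 0)
    {a : Lattice d} (ha : a ∈ l) : p a ≠ 0 := by
  intro h0
  exact h (List.prod_eq_zero (List.mem_map.2 ⟨a, ha, h0⟩))

end Weights

/-! ### First passages and separating levels of finite paths -/

variable [NeZero d]

/-- All steps raise the level by at most one. -/
def SkipFree (l : List (Lattice d)) : Prop := ∀ a ∈ l, a 0 ≤ 1

theorem SkipFree.of_pathProb {p : Lattice d → ℝ≥0∞} (hp : ∀ a : Lattice d, p a ≠ 0 → a 0 ≤ 1)
    {l : List (Lattice d)} (h : pathProb p l ≠ 0) : SkipFree l :=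
  fun a ha => hp a (apply_ne_zero_of_pathProb h ha)

/-- The path from `s` with steps `l` ends at its first visit to levels `≥ n`, on level `n`. -/
def FirstPassage (s : Lattice d) (n : ℤ) (l : List (Lattice d)) : Prop :=
  (s + l.sum) 0 = n ∧ ∀ x ∈ sites s l, x 0 < n

/-- A first passage to level `n` for the path from the origin that stays at levels `≥ 0`. -/
def Upward (n : ℕ) (l : List (Lattice d)) : Prop :=
  FirstPassage 0 n l ∧ ∀ x ∈ sites 0 l, 0 ≤ x 0

/-- The path from `s` does not go below `m` after its first passage to level `m`. -/
def Separates (s : Lattice d) (l : List (Lattice d)) (m : ℤ) : Prop :=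
  ∃ l₁ l₂, l = l₁ ++ l₂ ∧ FirstPassage s m l₁ ∧ ∀ x ∈ sites (s + l₁.sum) l₂, m ≤ x 0

/-- The end of the shorter path lies on level n, yet would be a site of the longer path before its
end. Prefix-freeness is what makes the corresponding events disjoint. -/
theorem FirstPassage.prefix_eq {s : Lattice d} {n : ℤ} {l l' : List (Lattice d)}
    (h : FirstPassage s n l) (h' : FirstPassage s n l') (hl : l <+: l') : l = l' := by
  obtain ⟨c, rfl⟩ := hl
  by_contra hne
  have hc : c ≠ [] := by rintro rfl; simp at hne
  exact (h'.2 _ (mem_sites_prefix hc)).ne h.1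

/-- First passages along the same path are nested. -/
theorem FirstPassage.prefix_of_lt {s : Lattice d} {m n : ℤ} (hmn : m ≤ n)
    {l l₂ l' l₂' : List (Lattice d)} (h : FirstPassage s m l) (h' : FirstPassage s n l')
    (e : l ++ l₂ = l' ++ l₂') : ∃ c, l' = l ++ c ∧ l₂ = c ++ l₂' := by
  rcases List.append_eq_append_iff.1 e with ⟨c, h1, h2⟩ | ⟨c, h1, h2⟩
  · exact ⟨c, h1, h2⟩
  · rcases eq_or_ne c [] with rfl | hc
    · exact ⟨[], by simpa using h1.symm, by simpa using h2.symm⟩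
    · have := h.2 (s + l'.sum) (by rw [h1]; exact mem_sites_prefix hc)
      rw [h'.1] at this
      omega

theorem FirstPassage.append {s : Lattice d} {m n : ℤ} (hmn : m ≤ n) {l l₂ : List (Lattice d)}
    (h : FirstPassage s m l) (h₂ : FirstPassage (s + l.sum) n l₂) :
    FirstPassage s n (l ++ l₂) := by
  refine ⟨by rw [List.sum_append, ← add_assoc]; exact h₂.1, fun x hx => ?_⟩
  rw [sites_append, List.mem_append] at hx
  exact hx.elim (fun hx => (h.2 x hx).trans_le hmn) (h₂.2 x)

theorem firstPassage_shift {s : Lattice d} {n : ℤ} {l : List (Lattice d)} :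
    FirstPassage s n l ↔ FirstPassage 0 (n - s 0) l := by
  unfold FirstPassage
  refine and_congr (by simp only [Pi.add_apply, Pi.zero_apply]; omega) ?_
  constructor
  · intro h x hx
    have := h (x + s) (by rw [mem_sites_zero]; simpa using hx)
    simp only [Pi.add_apply] at this
    omega
  · intro h x hx
    have := h _ (mem_sites_zero.1 hx)
    simp only [Pi.sub_apply] at this
    omega

/-- Steps of height at most one cannot jump over level m, so the first entrance above it happens on
it. -/
theorem FirstPassage.split {s : Lattice d} {m : ℤ} {l : List (Lattice d)} (hl : SkipFree l)
    (hs : s 0 ≤ m) (he : m ≤ (s + l.sum) 0) :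
    ∃ l₁ l₂, l = l₁ ++ l₂ ∧ FirstPassage s m l₁ := by
  induction l generalizing s with
  | nil =>
    refine ⟨[], [], rfl, ?_, by simp⟩
    simp only [List.sum_nil, add_zero] at he ⊢
    omega
  | cons a l ih =>
    rcases hs.eq_or_lt with h | h
    · exact ⟨[], a :: l, rfl, by simpa using h, by simp⟩
    · have ha : a 0 ≤ 1 := hl a (by simp)
      obtain ⟨l₁, l₂, rfl, h1⟩ := ih (s := s + a) (fun b hb => hl b (by simp [hb]))
        (by simp only [Pi.add_apply]; omega) (by simpa [add_assoc] using he)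
      refine ⟨a :: l₁, l₂, rfl, by simpa [add_assoc] using h1.1, ?_⟩
      simpa using ⟨h, h1.2⟩

/-- A skip-free path from a level `≤ 0` to a positive level, cut at its last visit to level `0`. -/
theorem exists_last_visit {s : Lattice d} {l : List (Lattice d)} (hl : SkipFree l)
    (hx : ∃ x ∈ sites s l, x 0 ≤ 0) (he : 1 ≤ (s + l.sum) 0) :
    ∃ l₁ a l₂, l = l₁ ++ a :: l₂ ∧ (s + l₁.sum) 0 = 0 ∧
      ∀ x ∈ sites (s + l₁.sum + a) l₂, 1 ≤ x 0 := by
  induction l generalizing s with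
  | nil => simp at hx
  | cons a l ih =>
    by_cases h : ∃ x ∈ sites (s + a) l, x 0 ≤ 0
    · obtain ⟨l₁, b, l₂, rfl, h1, h2⟩ := ih (s := s + a) (fun b hb => hl b (by simp [hb])) h
        (by simpa [add_assoc] using he)
      exact ⟨a :: l₁, b, l₂, rfl, by simpa [add_assoc] using h1, by simpa [add_assoc] using h2⟩
    · push Not at h
      have ha : a 0 ≤ 1 := hl a (by simp)
      have hs : s 0 ≤ 0 := by
        obtain ⟨x, hx, hx0⟩ := hx
        rw [sites_cons, List.mem_cons] at hx
        rcases hx with rfl | hx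
        · exact hx0
        · exact absurd hx0 (by have := h x hx; omega)
      have h1 : 1 ≤ (s + a) 0 := by
        cases l with
        | nil => simpa using he
        | cons b l => exact h (s + a) (by simp)
      simp only [Pi.add_apply] at h1
      refine ⟨[], a, l, rfl, ?_, fun x hx => by have := h x (by simpa using hx); omega⟩
      simp only [List.sum_nil, add_zero]
      omega

/-- A path ending on level `0`, cut at its first visit to that level. -/
theorem exists_first_visit {s : Lattice d} {l : List (Lattice d)} (he : (s + l.sum) 0 = 0) :
    ∃ l₁ l₂, l = l₁ ++ l₂ ∧ (s + l₁.sum) 0 = 0 ∧ ∀ x ∈ sites s l₁, x 0 ≠ 0 := by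
  induction l generalizing s with
  | nil => exact ⟨[], [], rfl, he, by simp⟩
  | cons a l ih =>
    by_cases h : s 0 = 0
    · exact ⟨[], a :: l, rfl, by simpa using h, by simp⟩
    · obtain ⟨l₁, l₂, rfl, h1, h2⟩ := ih (s := s + a) (by simpa [add_assoc] using he)
      exact ⟨a :: l₁, l₂, rfl, by simpa [add_assoc] using h1, by simpa using ⟨h, h2⟩⟩

end LocalConstraints

end

/-! ### Renewal structure at separating levels -/

noncomputable section

namespace LocalConstraints

variable {d : ℕ} [NeZero d]

theorem Upward.level {n : ℕ} {l : List (Lattice d)} (h : Upward n l) {z x : Lattice d}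
    (hx : x ∈ sites z l) : z 0 ≤ x 0 ∧ x 0 < z 0 + n := by
  have hx := mem_sites_zero.1 hx
  have h1 := h.1.2 _ hx
  have h2 := h.2 _ hx
  simp only [Pi.sub_apply] at h1 h2
  omega

theorem Upward.firstPassage {n : ℕ} {l : List (Lattice d)} (h : Upward n l) (z : Lattice d) :
    FirstPassage z (z 0 + n) l := by
  rw [firstPassage_shift, add_sub_cancel_left]
  exact h.1

theorem upward_of_firstPassage {z : Lattice d} {n : ℤ} {j : ℕ} {l : List (Lattice d)}
    (h : FirstPassage z n l) (hj : z 0 + j = n) (hl : ∀ x ∈ sites z l, z 0 ≤ x 0) :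
    Upward j l := by
  refine ⟨by rw [firstPassage_shift, ← hj, add_sub_cancel_left] at h; exact h, fun x hx => ?_⟩
  have := hl (x + z) (by rw [mem_sites_zero]; simpa using hx)
  simp only [Pi.add_apply] at this
  omega

theorem FirstPassage.of_append {s : Lattice d} {n : ℤ} {l l₂ : List (Lattice d)}
    (h : FirstPassage s n (l ++ l₂)) : FirstPassage (s + l.sum) n l₂ := by
  refine ⟨by rw [add_assoc, ← List.sum_append]; exact h.1, fun x hx => h.2 x ?_⟩
  rw [sites_append]
  exact List.mem_append_right _ hx

theorem separates_of_append {s : Lattice d} {m n : ℤ} (hmn : m < n)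
    {l l₂ l' l₂' : List (Lattice d)} (h : FirstPassage s m l) (h' : FirstPassage s n l')
    (e : l ++ l₂ = l' ++ l₂') (hs : ∀ x ∈ sites (s + l.sum) l₂, m ≤ x 0) :
    Separates s l' m := by
  obtain ⟨c, rfl, rfl⟩ := h.prefix_of_lt hmn.le h' e
  refine ⟨l, c, rfl, h, fun x hx => hs x ?_⟩
  rw [sites_append]
  exact List.mem_append_left _ hx

theorem Separates.append {s : Lattice d} {m : ℤ} {l l₂ : List (Lattice d)}
    (h : Separates s l m) (h₂ : ∀ x ∈ sites (s + l.sum) l₂, m ≤ x 0) :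
    Separates s (l ++ l₂) m := by
  obtain ⟨a, b, rfl, ha, hb⟩ := h
  refine ⟨a, b ++ l₂, by simp, ha, fun x hx => ?_⟩
  rw [sites_append, List.mem_append] at hx
  refine hx.elim (hb x) fun hx => h₂ x ?_
  rwa [List.sum_append, ← add_assoc]

theorem FirstPassage.separates {s : Lattice d} {n : ℤ} {l : List (Lattice d)}
    (h : FirstPassage s n l) : Separates s l n := ⟨l, [], by simp, h, by simp⟩

/-- A first passage to level `m` with no separating level in `A` below `m`. -/
def Unseparated (A : Set ℕ) (s : Lattice d) (m : ℕ) (l : List (Lattice d)) : Prop :=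
  FirstPassage s m l ∧ ∀ j ∈ A, j < m → ¬ Separates s l j

section Cost

variable (p : Lattice d → ℝ≥0∞) (G : ℕ → ℝ≥0∞)

/-- The probability of the steps `l` from `s`, subject to the constraints at levels `≥ 0`. -/
def cost (s : Lattice d) (l : List (Lattice d)) : ℝ≥0∞ :=
  pathProb p l * allow G ((sites s l).filter fun x => 0 ≤ x 0)

open Classical in
/-- The total cost of the paths from `s` in the family `K`. -/
def total (s : Lattice d) (K : List (Lattice d) → Prop) : ℝ≥0∞ :=
  ∑' l, if K l then cost p G s l else 0

/-- The probability of reaching level `n` from the origin without going below level `0`. -/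
def climb (n : ℕ) : ℝ≥0∞ := total p G (0 : Lattice d) (Upward n)

variable {p G}

theorem total_mono {s : Lattice d} {K K' : List (Lattice d) → Prop} (h : ∀ l, K l → K' l) :
    total p G s K ≤ total p G s K' := by
  refine ENNReal.tsum_le_tsum fun l => ?_
  split_ifs with h1 h2
  · exact le_rfl
  · exact absurd (h l h1) h2
  · exact bot_le
  · exact le_rfl

theorem filter_sites_of_level {z : Lattice d} (hz : 0 ≤ z 0) {n : ℕ} {l : List (Lattice d)}
    (h : Upward n l) : ((sites z l).filter fun x => 0 ≤ x 0) = sites z l := by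
  rw [List.filter_eq_self]
  intro x hx
  simpa using hz.trans (h.level hx).1

/-- The first piece stays strictly below level m and the second at or above it, so they use disjoint
sets of constraints, and the second factor is translation invariant. -/
theorem cost_append {s : Lattice d} {m j : ℕ} {l l₂ : List (Lattice d)}
    (h : FirstPassage s m l) (h₂ : Upward j l₂) :
    cost p G s (l ++ l₂) = cost p G s l * cost p G 0 l₂ := by
  have hz : 0 ≤ (s + l.sum) 0 := by rw [h.1]; positivity
  unfold cost
  rw [pathProb_append, sites_append, List.filter_append, allow_append,
    filter_sites_of_level hz h₂, filter_sites_of_level (by simp) h₂, allow_sites]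
  · ring
  · intro x hx hx'
    have h1 := h.2 x (List.mem_of_mem_filter hx)
    have h2 := (h₂.level (List.mem_of_mem_filter hx')).1
    rw [h.1] at h2
    omega

theorem climb_zero : climb p G 0 = 1 := by
  classical
  unfold climb total
  rw [tsum_eq_single []]
  · rw [if_pos ⟨⟨by simp, by simp⟩, by simp⟩]
    simp [cost]
  · intro l hl
    rw [if_neg]
    intro h
    cases l with
    | nil => exact hl rfl
    | cons a l => simpa using h.1.2 0 (by simp)

theorem total_mul_total (s s' : Lattice d) (K K' : List (Lattice d) → Prop) :
    total p G s K * total p G s' K' = ∑' x : List (Lattice d) × List (Lattice d),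
      open Classical in if K x.1 ∧ K' x.2 then cost p G s x.1 * cost p G s' x.2 else 0 := by
  classical
  unfold total
  rw [tsum_mul_tsum]
  refine tsum_congr fun x => ?_
  by_cases h : K x.1 <;> by_cases h' : K' x.2 <;> simp [h, h']

theorem sum_total_mul_climb (A : Set ℕ) (I : Finset ℕ) (n : ℕ)
    (s : Lattice d) (F : ℕ → List (Lattice d) → Prop)
    (hF : ∀ m l, F m l → Unseparated A s m l) :
    ∑ m ∈ I, total p G s (F m) * climb p G (n - m) =
      ∑' x : I × (List (Lattice d) × List (Lattice d)),
        open Classical in if F x.1 x.2.1 ∧ Upward (n - x.1) x.2.2 then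
          cost p G s (x.2.1 ++ x.2.2) else 0 := by
  classical
  rw [ENNReal.tsum_prod', ← Finset.tsum_subtype]
  refine tsum_congr fun m => ?_
  rw [climb, total_mul_total]
  refine tsum_congr fun x => ?_
  dsimp only
  refine if_ctx_congr Iff.rfl (fun h => ?_) fun _ => rfl
  rw [cost_append (hF _ _ h.1).1 h.2]

/-- Paths concatenated at their first separating level in `A`. -/
theorem sum_total_mul_climb_le (A : Set ℕ) (I : Finset ℕ) (hA : ∀ m ∈ I, m ∈ A) (n : ℕ)
    (s : Lattice d) (F : ℕ → List (Lattice d) → Prop) (K : List (Lattice d) → Prop)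
    (hF : ∀ m l, F m l → Unseparated A s m l)
    (hK : ∀ m ∈ I, ∀ l l₂, F m l → Upward (n - m) l₂ → K (l ++ l₂)) :
    ∑ m ∈ I, total p G s (F m) * climb p G (n - m) ≤ total p G s K := by
  classical
  rw [sum_total_mul_climb A I n s F hF]
  refine tsum_le_tsum_of_rel (fun x l => x.2.1 ++ x.2.2 = l) ?_ ?_
  · rintro ⟨m, l, l₂⟩ h
    rw [ne_eq, ite_eq_right_iff, Classical.not_imp] at h
    refine ⟨l ++ l₂, rfl, ?_⟩
    rw [if_pos h.1, if_pos (hK m m.2 l l₂ h.1.1 h.1.2)]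
  -- The cut level can be read off the concatenated path: for m < m' the cut at m would be a
  -- separating level in A of the piece that ends at m'.
  · have key : ∀ (m m' : I) (l l₂ l' l₂' : List (Lattice d)), F m l → Upward (n - m) l₂ →
        F m' l' → l ++ l₂ = l' ++ l₂' → ¬ (m : ℕ) < m' := by
      intro m m' l l₂ l' l₂' h1 h2 h3 e hlt
      have hf := (hF _ _ h1).1
      refine (hF _ _ h3).2 m (hA m m.2) hlt
        (separates_of_append (by exact_mod_cast hlt) hf (hF _ _ h3).1 e fun x hx => ?_)
      rw [← hf.1]
      exact (h2.level hx).1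
    rintro ⟨m, l, l₂⟩ ⟨m', l', l₂'⟩ L h h' e e'
    rw [ne_eq, ite_eq_right_iff, Classical.not_imp] at h h'
    dsimp only at h h' e e'
    have hm : m = m' := by
      refine Subtype.ext (le_antisymm ?_ ?_)
      · exact not_lt.1 (key m' m l' l₂' l l₂ h'.1.1 h'.1.2 h.1.1 (e'.trans e.symm))
      · exact not_lt.1 (key m m' l l₂ l' l₂' h.1.1 h.1.2 h'.1.1 (e.trans e'.symm))
    subst hm
    have hl : l = l' := by
      obtain ⟨c, hc, -⟩ := (hF _ _ h.1.1).1.prefix_of_lt le_rfl (hF _ _ h'.1.1).1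
        (e.trans e'.symm)
      exact (hF _ _ h.1.1).1.prefix_eq (hF _ _ h'.1.1).1 ⟨c, hc.symm⟩
    subst hl
    have : l₂ = l₂' := List.append_cancel_left (e.trans e'.symm)
    rw [this]

/-- Here m is the lowest separating level of a first passage to level n. Only one inequality is
needed, so it suffices that gluing is injective. -/
theorem sum_unseparated_le (n : ℕ) (s : Lattice d) :
    ∑ m ∈ Finset.range (n + 1), total p G s (Unseparated Set.univ s m) * climb p G (n - m) ≤
      total p G s (FirstPassage s n) := by
  refine sum_total_mul_climb_le Set.univ _ (by simp) n s _ _ (fun m l h => h) ?_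
  intro m hm l l₂ h h₂
  have hm : m ≤ n := by simpa [Nat.lt_succ_iff] using hm
  refine h.1.append (by exact_mod_cast hm) ?_
  have := h₂.firstPassage (s + l.sum)
  rwa [h.1.1, Nat.cast_sub hm, add_sub_cancel] at this

/-- The probability that the first separating level after `0` of the path from the origin is `k`. -/
def step (p : Lattice d → ℝ≥0∞) (G : ℕ → ℝ≥0∞) (k : ℕ) : ℝ≥0∞ :=
  total p G (0 : Lattice d) fun l => Upward k l ∧ ∀ j, 0 < j → j < k → ¬ Separates 0 l j

/-- The renewal equation. Every climbing path is cut at its lowest positive separating level, which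
exists because the end level n + 1 always separates. -/
theorem climb_succ (n : ℕ) :
    climb p G (n + 1) =
      ∑ k ∈ Finset.Icc 1 (n + 1), step p G k * climb p G (n + 1 - k) := by
  classical
  have hF : ∀ m l, (Upward m l ∧ ∀ j, 0 < j → j < m → ¬ Separates (0 : Lattice d) l j) →
      Unseparated {j | 0 < j} 0 m l := fun m l h => ⟨h.1.1, h.2⟩
  have hA : ∀ m ∈ Finset.Icc 1 (n + 1), m ∈ {j : ℕ | 0 < j} := by
    intro m hm
    have := (Finset.mem_Icc.1 hm).1
    exact this
  refine le_antisymm ?_ ?_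
  · unfold step
    rw [sum_total_mul_climb _ _ (n + 1) 0 _ hF, climb, total]
    refine tsum_le_tsum_of_rel (fun l x => x.2.1 ++ x.2.2 = l) ?_ ?_
    · intro l h
      rw [ne_eq, ite_eq_right_iff, Classical.not_imp] at h
      have hl := h.1
      rw [if_pos hl]
      have hex : ∃ j : ℕ, 0 < j ∧ Separates (0 : Lattice d) l j :=
        ⟨n + 1, by simp, hl.1.separates⟩
      obtain ⟨h0, hj⟩ := Nat.find_spec hex
      have hle : Nat.find hex ≤ n + 1 := Nat.find_min' hex ⟨by simp, hl.1.separates⟩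
      have hmin := fun i => Nat.find_min (m := i) hex
      generalize Nat.find hex = j at h0 hj hle hmin
      obtain ⟨l₁, l₂, rfl, h1, h2⟩ := hj
      have hz := h1.1
      refine ⟨⟨⟨j, Finset.mem_Icc.2 ⟨h0, hle⟩⟩, l₁, l₂⟩, rfl, le_of_eq ?_⟩
      dsimp only
      rw [if_pos]
      refine ⟨⟨⟨h1, fun x hx => hl.2 x ?_⟩, fun i hi hij hsep => ?_⟩, ?_⟩
      · rw [sites_append]
        exact List.mem_append_left _ hx
      -- A separating level i < j of the first piece still separates the whole path, since the
      -- second piece stays at levels at least j.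
      · refine hmin i hij ⟨hi, hsep.append fun x hx => ?_⟩
        have := h2 x hx
        omega
      · refine upward_of_firstPassage hl.1.of_append ?_ fun x hx => hz ▸ h2 x hx
        rw [hz]
        omega
    · rintro l l' x - - h h'
      exact h.symm.trans h'
  · refine sum_total_mul_climb_le {j | 0 < j} _ hA (n + 1) 0 _ _ hF ?_
    intro m hm l l₂ h h₂
    have hm := (Finset.mem_Icc.1 hm).2
    have hz := h.1.1.1
    refine ⟨h.1.1.append (by exact_mod_cast hm) ?_, fun x hx => ?_⟩
    · have := h₂.firstPassage (0 + l.sum)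
      rwa [hz, Nat.cast_sub hm, add_sub_cancel] at this
    · rw [sites_append, List.mem_append] at hx
      refine hx.elim (h.1.2 x) fun hx => ?_
      have := (h₂.level hx).1
      omega

end Cost

end LocalConstraints

end

/-! ### Almost submultiplicativity and the Green function of level 0 -/

noncomputable section

namespace LocalConstraints

variable {d : ℕ} {G : ℕ → ℝ≥0∞}

theorem count_filter_append_le {M M' : List (Lattice d)} (A B C : Lattice d → Prop)
    [DecidablePred A] [DecidablePred B] [DecidablePred C] (hA : ∀ x, A x → C x)
    (hB : ∀ x, B x → C x) (y : Lattice d) :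
    (M.filter (fun x => A x) ++ M'.filter fun x => B x).count y ≤
      ((M ++ M').filter fun x => C x).count y := by
  rw [List.filter_append, List.count_append, List.count_append]
  refine add_le_add ?_ ?_
  · exact (List.monotone_filter_right M (by simpa using hA)).count_le y
  · exact (List.monotone_filter_right M' (by simpa using hB)).count_le y

/-- Forgetting visits only relaxes the constraints. Keeping from the two pieces only visits in
disjoint regions makes the weight factor. -/
theorem allow_filter_append_le (h0 : G 0 = 1) (hG : Antitone G) {M M' : List (Lattice d)}
    (A B C : Lattice d → Prop) [DecidablePred A] [DecidablePred B] [DecidablePred C]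
    (hA : ∀ x, A x → C x) (hB : ∀ x, B x → C x) (hAB : ∀ x, A x → ¬ B x) :
    allow G ((M ++ M').filter fun x => C x) ≤
      allow G (M.filter fun x => A x) * allow G (M'.filter fun x => B x) := by
  rw [← allow_append]
  · exact allow_anti h0 hG (count_filter_append_le A B C hA hB)
  · intro x hx hx'
    have h1 := List.of_mem_filter hx
    have h2 := List.of_mem_filter hx'
    exact hAB x (by simpa using h1) (by simpa using h2)

variable [NeZero d] {p : Lattice d → ℝ≥0∞}

open Classical in
/-- The expected number of visits of level `0` that the constraints on that level allow. -/
def levelGreen (p : Lattice d → ℝ≥0∞) (G : ℕ → ℝ≥0∞) (s : Lattice d) : ℝ≥0∞ :=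
  ∑' l : List (Lattice d), if (s + l.sum) 0 = 0 then
    pathProb p l * allow G ((sites s l).filter fun x => x 0 = 0) else 0

/-- The path from `s` ends at its first visit to level `0`. -/
def FirstVisit (s : Lattice d) (l : List (Lattice d)) : Prop :=
  (s + l.sum) 0 = 0 ∧ ∀ x ∈ sites s l, x 0 ≠ 0

/-- Cut at the last visit to level 0. Before the cut only the constraints on level 0 are kept, after
it only those at levels at least 1, and what follows the cut is a climb. -/
theorem total_firstPassage_le (hp : ∀ a : Lattice d, p a ≠ 0 → a 0 ≤ 1) (h0 : G 0 = 1)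
    (h1 : G 1 = 1) (hG : Antitone G) {s : Lattice d} (hs : s 0 ≤ 0) (n : ℕ) :
    total p G s (FirstPassage s n) ≤ levelGreen p G s * climb p G n := by
  classical
  unfold levelGreen climb total
  rw [tsum_mul_tsum]
  refine tsum_le_tsum_of_rel (fun l x => x.1 ++ x.2 = l) ?_ ?_
  · intro l h
    rw [ne_eq, ite_eq_right_iff, Classical.not_imp] at h
    obtain ⟨hl, hne⟩ := h
    rw [if_pos hl]
    have hsf : SkipFree l := SkipFree.of_pathProb hp (left_ne_zero_of_mul hne)
    -- For n = 0 the path ends on level 0 itself, so the climbing piece is empty.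
    rcases Nat.eq_zero_or_pos n with rfl | hn
    · refine ⟨(l, []), by simp, ?_⟩
      have hu : Upward (d := d) 0 [] := ⟨⟨by simp, by simp⟩, by simp⟩
      dsimp only
      rw [if_pos (by simpa using hl.1), if_pos hu, cost, cost]
      simp only [sites_nil, List.filter_nil, allow_nil, pathProb_nil, mul_one]
      gcongr
      refine allow_anti h0 hG fun y => ?_
      exact (List.monotone_filter_right _ (by simp +contextual)).count_le y
    · have hex : ∃ x ∈ sites s l, x 0 ≤ 0 := by
        cases l with
        | nil =>
          have := hl.1
          simp only [List.sum_nil, add_zero] at this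
          omega
        | cons a l => exact ⟨s, by simp, hs⟩
      obtain ⟨l₁, a, l₂, rfl, hz, h2⟩ := exists_last_visit hsf hex (by rw [hl.1]; omega)
      have hfp := hl.of_append
      have hu : Upward n (a :: l₂) := by
        refine upward_of_firstPassage hfp (by rw [hz, zero_add]) ?_
        intro x hx
        rw [sites_cons, List.mem_cons] at hx
        rcases hx with rfl | hx
        · exact le_rfl
        · have := h2 x hx
          omega
      refine ⟨(l₁, a :: l₂), rfl, ?_⟩
      dsimp only
      rw [if_pos hz, if_pos hu, cost, cost, pathProb_append, sites_append]
      -- The climb visits its starting site just once and is above level 0 afterwards, so removing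
      -- that visit leaves its weight unchanged.
      have hsites : allow G ((sites 0 (a :: l₂)).filter fun x => 0 ≤ x 0) =
          allow G ((sites (s + l₁.sum) (a :: l₂)).filter fun x => 1 ≤ x 0) := by
        rw [filter_sites_of_level (by simp) hu, ← allow_sites (s + l₁.sum), sites_cons,
          List.filter_cons_of_neg (by simp [hz]), List.filter_eq_self.2, allow_cons h1]
        · intro hx
          have := h2 _ hx
          omega
        · intro x hx
          simpa using h2 x hx
      rw [hsites]
      calc _ ≤ pathProb p l₁ * pathProb p (a :: l₂) * (_ * _) := by
            gcongr
            exact allow_filter_append_le h0 hG (fun x => x 0 = 0) (fun x => 1 ≤ x 0) _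
              (fun x hx => hx.ge) (fun x hx => by omega) (fun x hx => by omega)
        _ = _ := by ring
  · rintro l l' x - - h h'
    exact h.symm.trans h'

/-- Cut at the first passage to level a. The second piece may return below a, but only its visits at
levels at least a are kept, and the first piece makes none there. -/
theorem climb_add_le (hp : ∀ a : Lattice d, p a ≠ 0 → a 0 ≤ 1) (h0 : G 0 = 1)
    (hG : Antitone G) (a b : ℕ) :
    climb p G (a + b) ≤ climb p G a * total p G (0 : Lattice d) (FirstPassage 0 b) := by
  classical
  unfold climb
  rw [total_mul_total, total]
  refine tsum_le_tsum_of_rel (fun l x => x.1 ++ x.2 = l) ?_ ?_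
  · intro l h
    rw [ne_eq, ite_eq_right_iff, Classical.not_imp] at h
    obtain ⟨hl, hne⟩ := h
    rw [if_pos hl]
    have hsf : SkipFree l := SkipFree.of_pathProb hp (left_ne_zero_of_mul hne)
    obtain ⟨l₁, l₂, rfl, h1⟩ := FirstPassage.split (s := 0) (m := a) hsf (by simp)
      (by rw [hl.1.1]; simp)
    have hfp := hl.1.of_append
    have hz := h1.1
    refine ⟨(l₁, l₂), rfl, ?_⟩
    dsimp only
    have hu : Upward a l₁ := ⟨h1, fun x hx => hl.2 x (by
      rw [sites_append]; exact List.mem_append_left _ hx)⟩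
    have hfp' : FirstPassage 0 b l₂ := by
      rw [firstPassage_shift, hz] at hfp
      simpa using hfp
    rw [if_pos ⟨hu, hfp'⟩]
    unfold cost
    rw [pathProb_append, sites_append]
    have e : allow G ((sites 0 l₂).filter fun x => 0 ≤ x 0) =
        allow G ((sites (0 + l₁.sum) l₂).filter fun x => (a : ℤ) ≤ x 0) := by
      rw [zero_add] at hz ⊢
      have h := sites_add 0 l₁.sum l₂
      rw [zero_add] at h
      rw [h, List.filter_map, allow_map_add]
      congr 1
      refine List.filter_congr fun x _ => ?_
      simp [hz]
    have e' : ((sites 0 l₁).filter fun x => 0 ≤ x 0) =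
        ((sites 0 l₁).filter fun x => 0 ≤ x 0 ∧ x 0 < (a : ℤ)) := by
      refine List.filter_congr fun x hx => ?_
      have := h1.2 x hx
      simp [this]
    rw [e, e']
    calc _ ≤ pathProb p l₁ * pathProb p l₂ * (_ * _) := by
          gcongr
          exact allow_filter_append_le h0 hG (fun x => 0 ≤ x 0 ∧ x 0 < (a : ℤ))
            (fun x => (a : ℤ) ≤ x 0) _ (fun x hx => hx.1) (fun x hx => by omega)
            (fun x hx => by omega)
      _ = _ := by ring
  · rintro l l' x - - h h'
    exact h.symm.trans h'

theorem levelGreen_eq {z : Lattice d} (hz : z 0 = 0) : levelGreen p G z = levelGreen p G 0 := by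
  unfold levelGreen
  refine tsum_congr fun l => ?_
  have h := sites_add 0 z l
  rw [zero_add] at h
  rw [h, List.filter_map, allow_map_add]
  simp [Function.comp_def, hz]

/-- Nothing happens on level 0 before its first visit; from then on the walk is a translate of the
one started at the origin. -/
theorem levelGreen_le (h0 : G 0 = 1) (hG : Antitone G) (s : Lattice d) :
    levelGreen p G s ≤
      (∑' l, open Classical in if FirstVisit s l then pathProb p l else 0) *
        levelGreen p G 0 := by
  classical
  have : (∑' l, if FirstVisit s l then pathProb p l else 0) * levelGreen p G 0 =
      ∑' x : List (Lattice d) × List (Lattice d), if FirstVisit s x.1 then pathProb p x.1 *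
        (if (s + x.1.sum + x.2.sum) 0 = 0 then pathProb p x.2 *
          allow G ((sites (s + x.1.sum) x.2).filter fun x => x 0 = 0) else 0) else 0 := by
    rw [ENNReal.tsum_prod', ← ENNReal.tsum_mul_right]
    refine tsum_congr fun l => ?_
    dsimp only
    split_ifs with h
    · rw [ENNReal.tsum_mul_left, ← levelGreen_eq h.1, levelGreen]
    · simp
  rw [this, levelGreen]
  refine tsum_le_tsum_of_rel (fun l x => x.1 ++ x.2 = l) ?_ ?_
  · intro l h
    rw [ne_eq, ite_eq_right_iff, Classical.not_imp] at h
    obtain ⟨hl, -⟩ := h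
    rw [if_pos hl]
    obtain ⟨l₁, l₂, rfl, h1, h2⟩ := exists_first_visit hl
    refine ⟨(l₁, l₂), rfl, ?_⟩
    dsimp only
    rw [if_pos ⟨h1, h2⟩, if_pos (by simpa [add_assoc] using hl), pathProb_append, mul_assoc,
      sites_append, List.filter_append]
    gcongr
    refine allow_anti h0 hG fun x => ?_
    rw [List.count_append]
    exact Nat.le_add_left _ _
  · rintro l l' x - - h h'
    exact h.symm.trans h'

/-! ### The walk induced on level 0 -/

section InducedWalk

/-- The expectation of `F` over `j` independent steps with (sub-)distribution `ρ`. -/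
def expect (ρ : Lattice d → ℝ≥0∞) : ℕ → (List (Lattice d) → ℝ≥0∞) → ℝ≥0∞
  | 0, F => F []
  | j + 1, F => ∑' y, ρ y * expect ρ j fun l => F (y :: l)

open Classical in
/-- The distribution of the displacement between consecutive visits of level `0`. -/
def excursion (p : Lattice d → ℝ≥0∞) (y : Lattice d) : ℝ≥0∞ :=
  ∑' l : List (Lattice d), if l ≠ [] ∧ l.sum = y ∧ y 0 = 0 ∧ ∀ x ∈ (sites 0 l).tail, x 0 ≠ 0
    then pathProb p l else 0

theorem tsum_excursion_mul (g : Lattice d → ℝ≥0∞) :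
    ∑' y, excursion p y * g y =
      ∑' l : List (Lattice d), open Classical in
        if l ≠ [] ∧ l.sum 0 = 0 ∧ ∀ x ∈ (sites 0 l).tail, x 0 ≠ 0 then
          pathProb p l * g l.sum else 0 := by
  classical
  unfold excursion
  simp_rw [← ENNReal.tsum_mul_right]
  rw [ENNReal.tsum_comm]
  refine tsum_congr fun l => ?_
  rw [tsum_eq_single l.sum]
  · simp
  · intro y hy
    rw [if_neg (fun h => hy h.2.1.symm), zero_mul]

/-- Induction on the number of visits: peel off the first excursion. A path ending on level 0 after
j visits consists of j excursions, and the sites it visits there are those of the induced walk. -/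
theorem tsum_visits_le (j : ℕ) (s : Lattice d) (hs : s 0 = 0)
    (F : List (Lattice d) → ℝ≥0∞) :
    ∑' l : List (Lattice d), (open Classical in
      if l.sum 0 = 0 ∧ ((sites s l).filter fun x => x 0 = 0).length = j then
        pathProb p l * F ((sites s l).filter fun x => x 0 = 0) else 0) ≤
      expect (excursion p) j fun L => F (sites s L) := by
  classical
  induction j generalizing s F with
  | zero =>
    refine (tsum_eq_single [] fun l hl => ?_).le.trans ?_
    · rw [if_neg]
      rintro ⟨-, h⟩
      cases l with
      | nil => exact hl rfl
      | cons a l => simp [hs] at h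
    · simp [expect]
  | succ j ih =>
    rw [expect, tsum_excursion_mul]
    calc _ ≤ ∑' x : List (Lattice d) × List (Lattice d),
          if x.1 ≠ [] ∧ x.1.sum 0 = 0 ∧ ∀ y ∈ (sites 0 x.1).tail, y 0 ≠ 0 then
            pathProb p x.1 * (if x.2.sum 0 = 0 ∧
              ((sites (s + x.1.sum) x.2).filter fun x => x 0 = 0).length = j then
              pathProb p x.2 *
                F (s :: (sites (s + x.1.sum) x.2).filter fun x => x 0 = 0) else 0) else 0 := ?_
      _ ≤ _ := ?_
    · refine tsum_le_tsum_of_rel (fun l x => x.1 ++ x.2 = l) ?_ ?_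
      · intro l h
        rw [ne_eq, ite_eq_right_iff, Classical.not_imp] at h
        obtain ⟨⟨hl, hc⟩, -⟩ := h
        rw [if_pos ⟨hl, hc⟩]
        cases l with
        | nil => simp at hc
        | cons a l =>
          obtain ⟨l₁, l₂, rfl, h1, h2⟩ := exists_first_visit (s := a) (l := l) (by simpa using hl)
          refine ⟨(a :: l₁, l₂), rfl, ?_⟩
          have hsites : (sites s (a :: (l₁ ++ l₂))).filter (fun x => x 0 = 0) =
              s :: (sites (s + (a :: l₁).sum) l₂).filter fun x => x 0 = 0 := by
            rw [sites_cons, List.filter_cons_of_pos (by simp [hs]), sites_append,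
              List.filter_append, (List.filter_eq_nil_iff (l := sites (s + a) l₁)).2]
            · simp [add_assoc]
            · intro x hx
              rw [add_comm s a, mem_sites_add] at hx
              have := h2 _ hx
              simpa [hs] using this
          rw [hsites] at hc ⊢
          dsimp only
          rw [if_pos ⟨by simp, by simpa using h1, by simpa using h2⟩, if_pos]
          · rw [← List.cons_append, pathProb_append, mul_assoc]
          · refine ⟨?_, by simpa using hc⟩
            simp only [List.sum_cons, List.sum_append, Pi.add_apply] at hl h1
            omega
      · rintro l l' x - - h h'
        exact h.symm.trans h'
    · rw [ENNReal.tsum_prod']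
      refine ENNReal.tsum_le_tsum fun l => ?_
      dsimp only
      split_ifs with h
      · rw [ENNReal.tsum_mul_left]
        gcongr
        refine (ih (s + l.sum) (by simp [hs, h.2.1]) fun M => F (s :: M)).trans ?_
        rfl
      · simp

theorem levelGreen_zero_le :
    levelGreen p G 0 ≤ ∑' j, expect (excursion p) j fun L => allow G (sites 0 L) := by
  classical
  refine le_trans ?_ (ENNReal.tsum_le_tsum fun j =>
    tsum_visits_le j (0 : Lattice d) rfl (allow G))
  rw [ENNReal.tsum_comm]
  refine ENNReal.tsum_le_tsum fun l => ?_
  refine le_trans ?_ (ENNReal.le_tsum (((sites 0 l).filter fun x => x 0 = 0).length))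
  simp

end InducedWalk

end LocalConstraints

end

/-! ### Binomial estimates and spreading of a random walk -/

noncomputable section

namespace LocalConstraints

section Binomial

/-- Induction through (n + 1) C_{n+1} = 2 (2n + 1) C_n and (2n + 1)(2n + 3) ≤ 4 (n + 1)². -/
theorem centralBinom_sq_mul_le (n : ℕ) : n.centralBinom ^ 2 * (2 * n + 1) ≤ 16 ^ n := by
  induction n with
  | zero => simp
  | succ n ih =>
    have h := Nat.succ_mul_centralBinom_succ n
    have h2 : (n + 1) ^ 2 * ((n + 1).centralBinom ^ 2 * (2 * (n + 1) + 1)) ≤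
        (n + 1) ^ 2 * 16 ^ (n + 1) := by
      calc _ = ((n + 1) * (n + 1).centralBinom) ^ 2 * (2 * n + 3) := by ring
        _ = 4 * ((2 * n + 1) * (2 * n + 3)) * (n.centralBinom ^ 2 * (2 * n + 1)) := by
          rw [h]; ring
        _ ≤ 4 * (4 * (n + 1) ^ 2) * 16 ^ n :=
          Nat.mul_le_mul (Nat.mul_le_mul_left 4 (by nlinarith)) ih
        _ = _ := by ring
    exact Nat.le_of_mul_le_mul_left h2 (by positivity)

theorem choose_half_sq_mul_le (i : ℕ) : (i.choose (i / 2)) ^ 2 * (i + 1) ≤ 4 ^ i := by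
  rcases Nat.even_or_odd' i with ⟨n, rfl | rfl⟩
  · have := centralBinom_sq_mul_le n
    rw [Nat.centralBinom] at this
    rw [Nat.mul_div_cancel_left _ (by norm_num), pow_mul]
    exact this
  · have h := centralBinom_sq_mul_le (n + 1)
    -- For odd i the middle coefficient is half of the next central one, which reduces this case to
    -- the even one.
    have h2 : (n + 1).centralBinom = 2 * (2 * n + 1).choose n := by
      rw [Nat.centralBinom, show 2 * (n + 1) = 2 * n + 1 + 1 by ring, Nat.choose_succ_succ,
        Nat.choose_symm_half]
      ring
    have h3 : (2 * n + 1) / 2 = n := by omega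
    rw [h3]
    rw [h2] at h
    have h4 : 4 * ((2 * n + 1).choose n ^ 2 * (2 * n + 1 + 1)) ≤ 4 * 4 ^ (2 * n + 1) := by
      calc _ ≤ (2 * (2 * n + 1).choose n) ^ 2 * (2 * (n + 1) + 1) := by
            rw [mul_pow]; nlinarith [Nat.zero_le ((2 * n + 1).choose n ^ 2)]
        _ ≤ 16 ^ (n + 1) := h
        _ = _ := by
          rw [show (16 : ℕ) = 4 ^ 2 by norm_num, ← pow_mul]; ring
    omega

/-- The previous bound is of order 2^i / √(i + 1). The inequality of the means with a free ε
replaces the root by an expression linear in 1/(i + 1), whose binomial average is explicit. -/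
theorem choose_half_le {ε : ℝ} (hε : 0 < ε) (i : ℕ) :
    (i.choose (i / 2) : ℝ) ≤ 2 ^ i * (ε / 2 + (2 * ε)⁻¹ * (i + 1 : ℝ)⁻¹) := by
  have h : ((i.choose (i / 2) : ℝ)) ^ 2 * (i + 1) ≤ (2 ^ i) ^ 2 := by
    rw [← pow_mul, mul_comm i 2, pow_mul]
    have := choose_half_sq_mul_le i
    norm_num
    exact_mod_cast this
  have hi : (0 : ℝ) < i + 1 := by positivity
  set c : ℝ := (i.choose (i / 2) : ℝ)
  have hc : 0 ≤ c := Nat.cast_nonneg _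
  have hT : (0 : ℝ) < 2 ^ i := by positivity
  generalize (2 : ℝ) ^ i = T at h hT
  have key : c * (2 * ε * (i + 1)) ≤ T * (ε ^ 2 * (i + 1) + 1) := by
    refine le_of_mul_le_mul_left ?_ hT
    nlinarith [mul_nonneg hi.le (sq_nonneg (c - ε * T))]
  rw [← le_div_iff₀ (by positivity)] at key
  refine key.trans (le_of_eq ?_)
  field_simp

/-- Absorbing 1/(i + 1) into the coefficient turns the sum into the binomial expansion of order m +
1 without its term 0. -/
theorem sum_binomial_inv_le {p : ℝ} (hp : 0 < p) (hp1 : p ≤ 1) (m : ℕ) :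
    ∑ i ∈ Finset.range (m + 1), (m.choose i : ℝ) * p ^ i * (1 - p) ^ (m - i) *
      (i + 1 : ℝ)⁻¹ ≤ (p * (m + 1))⁻¹ := by
  have h1 : ∑ i ∈ Finset.range (m + 1 + 1),
      p ^ i * (1 - p) ^ (m + 1 - i) * ((m + 1).choose i : ℝ) = 1 := by
    rw [← add_pow]; simp
  rw [Finset.sum_range_succ'] at h1
  have h2 : ∀ i ∈ Finset.range (m + 1), (m.choose i : ℝ) * p ^ i * (1 - p) ^ (m - i) *
      (i + 1 : ℝ)⁻¹ = (p * (m + 1))⁻¹ *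
        (p ^ (i + 1) * (1 - p) ^ (m + 1 - (i + 1)) * ((m + 1).choose (i + 1) : ℝ)) := by
    intro i _
    have h := Nat.add_one_mul_choose_eq m i
    have h' : ((m : ℝ) + 1) * m.choose i = (m + 1).choose (i + 1) * (i + 1) := by
      exact_mod_cast h
    rw [Nat.add_sub_add_right]
    field_simp
    linear_combination (p ^ (i + 1) * (1 - p) ^ (m - i)) * h'
  rw [Finset.sum_congr rfl h2, ← Finset.mul_sum]
  have h3 : 0 ≤ p ^ 0 * (1 - p) ^ (m + 1 - 0) * ((m + 1).choose 0 : ℝ) := by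
    have : 0 ≤ 1 - p := by linarith
    positivity
  have : (0 : ℝ) ≤ (p * (m + 1))⁻¹ := by positivity
  nlinarith

/-- A binomial mixture of the concentration functions of fair coin tossing is small. -/
theorem sum_binomial_choose_half_le {δ ε : ℝ} (hδ : 0 < δ) (hδ1 : 2 * δ ≤ 1) (hε : 0 < ε)
    (m : ℕ) :
    ∑ i ∈ Finset.range (m + 1), (m.choose i : ℝ) * δ ^ i * (1 - 2 * δ) ^ (m - i) *
      (i.choose (i / 2) : ℝ) ≤ ε / 2 + (2 * ε)⁻¹ * (2 * δ * (m + 1))⁻¹ := by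
  have hp : 0 ≤ 1 - 2 * δ := by linarith
  have h1 : ∑ i ∈ Finset.range (m + 1),
      (m.choose i : ℝ) * (2 * δ) ^ i * (1 - 2 * δ) ^ (m - i) = 1 := by
    have : ∑ i ∈ Finset.range (m + 1),
      (2 * δ) ^ i * (1 - 2 * δ) ^ (m - i) * (m.choose i : ℝ) = 1 := by
      rw [← add_pow]; simp
    exact (Finset.sum_congr rfl fun i _ => by ring).trans this
  have h2 := sum_binomial_inv_le (p := 2 * δ) (by positivity) hδ1 m
  calc _ ≤ ∑ i ∈ Finset.range (m + 1),
        ((ε / 2) * ((m.choose i : ℝ) * (2 * δ) ^ i * (1 - 2 * δ) ^ (m - i)) +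
        (2 * ε)⁻¹ * ((m.choose i : ℝ) * (2 * δ) ^ i * (1 - 2 * δ) ^ (m - i) *
          (i + 1 : ℝ)⁻¹)) := by
        refine Finset.sum_le_sum fun i _ => ?_
        calc _ ≤ (m.choose i : ℝ) * δ ^ i * (1 - 2 * δ) ^ (m - i) *
              (2 ^ i * (ε / 2 + (2 * ε)⁻¹ * (i + 1 : ℝ)⁻¹)) := by
              gcongr
              exact choose_half_le hε i
          _ = _ := by rw [mul_pow]; ring
    _ ≤ _ := by
        rw [Finset.sum_add_distrib, ← Finset.mul_sum, ← Finset.mul_sum, h1, mul_one]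
        gcongr

end Binomial

variable {d : ℕ} {ρ : Lattice d → ℝ≥0∞}

section Expect

theorem expect_mono {j : ℕ} {F F' : List (Lattice d) → ℝ≥0∞} (h : ∀ l, l.length = j → F l ≤ F' l) :
    expect ρ j F ≤ expect ρ j F' := by
  induction j generalizing F F' with
  | zero => exact h [] rfl
  | succ j ih =>
    refine ENNReal.tsum_le_tsum fun y => ?_
    gcongr
    exact ih fun l hl => h _ (by simp [hl])

theorem expect_const_mul (c : ℝ≥0∞) (j : ℕ) (F : List (Lattice d) → ℝ≥0∞) :
    expect ρ j (fun l => c * F l) = c * expect ρ j F := by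
  induction j generalizing F with
  | zero => rfl
  | succ j ih =>
    simp only [expect, ih, ← ENNReal.tsum_mul_left]
    exact tsum_congr fun y => by ring

theorem expect_add (j : ℕ) (F F' : List (Lattice d) → ℝ≥0∞) :
    expect ρ j (fun l => F l + F' l) = expect ρ j F + expect ρ j F' := by
  induction j generalizing F F' with
  | zero => rfl
  | succ j ih => simp only [expect, ih, mul_add, ENNReal.tsum_add]

theorem expect_one (j : ℕ) : expect ρ j (fun _ => 1) = (∑' y, ρ y) ^ j := by
  induction j with
  | zero => simp [expect]
  | succ j ih => rw [expect, ih, ENNReal.tsum_mul_right, pow_succ']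

theorem expect_append (a b : ℕ) (F : List (Lattice d) → ℝ≥0∞) :
    expect ρ (a + b) F = expect ρ a fun l => expect ρ b fun l' => F (l ++ l') := by
  induction a generalizing F with
  | zero => simp [expect]
  | succ a ih => rw [Nat.succ_add, expect, expect]; simp [ih]

theorem pathProb_le_expect (l : List (Lattice d)) (F : List (Lattice d) → ℝ≥0∞) :
    pathProb ρ l * F l ≤ expect ρ l.length F := by
  induction l generalizing F with
  | nil => simp [expect]
  | cons a l ih =>
    rw [List.length_cons, expect, pathProb_cons, mul_assoc]
    refine le_trans ?_ (ENNReal.le_tsum a)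
    gcongr
    exact ih fun l => F (a :: l)

end Expect

section Convolution

/-- The transition operator of the random walk with step distribution `ρ`. -/
def transition (ρ : Lattice d → ℝ≥0∞) : Module.End ℝ≥0∞ (Lattice d → ℝ≥0∞) where
  toFun f x := ∑' y, ρ y * f (x + y)
  map_add' f g := by
    funext x
    simp [mul_add, ENNReal.tsum_add]
  map_smul' c f := by
    funext x
    simp only [Pi.smul_apply, smul_eq_mul, RingHom.id_apply, ← ENNReal.tsum_mul_left]
    exact tsum_congr fun y => by ring

/-- The translation operator. -/
def translate (v : Lattice d) : Module.End ℝ≥0∞ (Lattice d → ℝ≥0∞) where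
  toFun f x := f (x + v)
  map_add' _ _ := rfl
  map_smul' _ _ := rfl

theorem transition_apply (f : Lattice d → ℝ≥0∞) (x : Lattice d) :
    transition ρ f x = ∑' y, ρ y * f (x + y) := rfl

@[simp] theorem translate_apply (v : Lattice d) (f : Lattice d → ℝ≥0∞) (x : Lattice d) :
    translate v f x = f (x + v) := rfl

theorem translate_pow_apply (v : Lattice d) (k : ℕ) (f : Lattice d → ℝ≥0∞) (x : Lattice d) :
    (translate v ^ k) f x = f (x + k • v) := by
  induction k generalizing f with
  | zero => simp
  | succ k ih => rw [pow_succ, Module.End.mul_apply, ih, translate_apply, add_assoc, succ_nsmul]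

theorem commute_translate (v w : Lattice d) : Commute (translate v) (translate w) := by
  refine LinearMap.ext fun f => funext fun x => ?_
  simp [Module.End.mul_apply, add_right_comm]

theorem commute_transition_translate (v : Lattice d) :
    Commute (transition ρ) (translate v) := by
  refine LinearMap.ext fun f => funext fun x => ?_
  simp [Module.End.mul_apply, transition_apply, add_right_comm]

theorem expect_sum (j : ℕ) (f : Lattice d → ℝ≥0∞) (x : Lattice d) :
    expect ρ j (fun l => f (x + l.sum)) = (transition ρ ^ j) f x := by
  induction j generalizing x with
  | zero => simp [expect]
  | succ j ih =>
    rw [expect, pow_succ', Module.End.mul_apply, transition_apply]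
    refine tsum_congr fun y => ?_
    rw [← ih (x + y)]
    simp [add_assoc]

theorem transition_pow_le {c : ℝ≥0∞} {f : Lattice d → ℝ≥0∞} (hf : ∀ x, f x ≤ c) (j : ℕ)
    (x : Lattice d) : (transition ρ ^ j) f x ≤ (∑' y, ρ y) ^ j * c := by
  rw [← expect_sum, ← expect_one, mul_comm, ← expect_const_mul]
  exact expect_mono fun l _ => by simpa using hf _

/-- Since v ≠ w, the i + 1 possible end points are distinct, so at most `A.card` of them lie in A,
each with multiplicity at most the middle binomial coefficient. -/
theorem coin_pow_le {v w : Lattice d} (hvw : v ≠ w) (A : Finset (Lattice d)) (i : ℕ)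
    (x : Lattice d) :
    ((translate v + translate w) ^ i) (fun y => if y ∈ A then 1 else 0) x ≤
      (i.choose (i / 2) : ℝ≥0∞) * A.card := by
  rw [(commute_translate v w).add_pow, LinearMap.sum_apply, Finset.sum_apply]
  have h1 : ∀ k ∈ Finset.range (i + 1),
      (translate v ^ k * translate w ^ (i - k) * (i.choose k : Module.End ℝ≥0∞ (Lattice d → ℝ≥0∞)))
        (fun y => if y ∈ A then 1 else 0) x ≤
      (i.choose (i / 2) : ℝ≥0∞) * if x + k • v + (i - k) • w ∈ A then 1 else 0 := by
    intro k _
    have e : (translate v ^ k * translate w ^ (i - k) * (i.choose k : Module.End ℝ≥0∞ (Lattice d → ℝ≥0∞))) =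
        (i.choose k) • (translate v ^ k * translate w ^ (i - k)) := by
      rw [← Nat.cast_comm, nsmul_eq_mul]
    rw [e, LinearMap.smul_apply, Pi.smul_apply, Module.End.mul_apply, translate_pow_apply,
      translate_pow_apply, nsmul_eq_mul]
    gcongr
    exact Nat.choose_le_middle k i
  refine (Finset.sum_le_sum h1).trans ?_
  rw [← Finset.mul_sum]
  gcongr
  rw [← Finset.sum_filter, Finset.sum_const, nsmul_eq_mul, mul_one]
  norm_cast
  refine Finset.card_le_card_of_injOn (fun k => x + k • v + (i - k) • w) ?_ ?_
  · intro k hk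
    simpa using (Finset.mem_filter.1 hk).2
  · intro k hk k' hk' h
    have hk : k ≤ i := by
      have := (Finset.mem_filter.1 hk).1
      simpa [Nat.lt_succ_iff] using this
    have hk' : k' ≤ i := by
      have := (Finset.mem_filter.1 hk').1
      simpa [Nat.lt_succ_iff] using this
    obtain ⟨c, hc⟩ := Function.ne_iff.1 hvw
    have := congrFun h c
    simp only [Pi.add_apply, Pi.smul_apply] at this
    simp only [nsmul_eq_mul, Nat.cast_sub hk, Nat.cast_sub hk'] at this
    have h3 : ((k : ℤ) - k') * (v c - w c) = 0 := by linear_combination this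
    rcases mul_eq_zero.1 h3 with h4 | h4
    · omega
    · exact absurd (by omega) hc

theorem transition_eq_add {v w : Lattice d} (hvw : v ≠ w) {δ : ℝ≥0∞} (hv : δ ≤ ρ v)
    (hw : δ ≤ ρ w) : ∃ r : Lattice d → ℝ≥0∞, ∑' y, ρ y = ∑' y, r y + 2 * δ ∧
      transition ρ = transition r + δ • (translate v + translate w) := by
  classical
  set e : Lattice d → ℝ≥0∞ := fun y => (if y = v then δ else 0) + if y = w then δ else 0
  have he : ∀ y, ρ y = (ρ y - e y) + e y := by
    intro y
    refine (tsub_add_cancel_of_le ?_).symm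
    by_cases h1 : y = v
    · subst h1; simpa [e, hvw] using hv
    · by_cases h2 : y = w
      · subst h2; simpa [e, h1] using hw
      · simp [e, h1, h2]
  refine ⟨fun y => ρ y - e y, ?_, LinearMap.ext fun f => funext fun x => ?_⟩
  · rw [tsum_congr he, ENNReal.tsum_add]
    congr 1
    simp only [e]
    rw [ENNReal.tsum_add, tsum_ite_eq, tsum_ite_eq, two_mul]
  · rw [transition_apply, LinearMap.add_apply, Pi.add_apply, transition_apply,
      tsum_congr fun y => congrArg (· * f (x + y)) (he y)]
    simp only [add_mul, ENNReal.tsum_add]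
    congr 1
    simp only [e, add_mul, ENNReal.tsum_add, ite_mul, zero_mul]
    rw [tsum_ite_eq, tsum_ite_eq]
    simp

/-- Split from ρ a fair coin between v and w, of mass 2δ. The operators commute, so the m steps are
sorted by the number i of coin steps: these give the concentration bound, and the others preserve it
up to the factor r^(m-i). -/
theorem transition_pow_indicator_le {v w : Lattice d} (hvw : v ≠ w) {δ : ℝ≥0∞} (hv : δ ≤ ρ v)
    (hw : δ ≤ ρ w) : ∃ r : ℝ≥0∞, ∑' y, ρ y = r + 2 * δ ∧
      ∀ (m : ℕ) (A : Finset (Lattice d)) (x : Lattice d),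
      (transition ρ ^ m) (fun y => if y ∈ A then 1 else 0) x ≤
      (∑ i ∈ Finset.range (m + 1),
        (m.choose i : ℝ≥0∞) * δ ^ i * r ^ (m - i) * (i.choose (i / 2) : ℝ≥0∞)) * A.card := by
  obtain ⟨r, hr, h⟩ := transition_eq_add hvw hv hw
  refine ⟨_, hr, fun m A x => ?_⟩
  have hc : Commute (δ • (translate v + translate w)) (transition r) :=
    (((commute_transition_translate v).add_right (commute_transition_translate w)).smul_right
      δ).symm
  rw [h, add_comm, hc.add_pow, LinearMap.sum_apply, Finset.sum_apply, Finset.sum_mul]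
  refine Finset.sum_le_sum fun i _ => ?_
  have e : (δ • (translate v + translate w)) ^ i * transition r ^ (m - i) *
      (m.choose i : Module.End ℝ≥0∞ (Lattice d → ℝ≥0∞)) =
      (m.choose i) • (δ ^ i • (transition r ^ (m - i) * (translate v + translate w) ^ i)) := by
    rw [← Nat.cast_comm, (hc.pow_pow i (m - i)).eq, ← nsmul_eq_mul, smul_pow,
      mul_smul_comm]
  rw [e, LinearMap.smul_apply, Pi.smul_apply, LinearMap.smul_apply, Pi.smul_apply,
    Module.End.mul_apply, nsmul_eq_mul, smul_eq_mul, mul_assoc, mul_assoc, mul_assoc]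
  gcongr
  exact transition_pow_le (coin_pow_le hvw A i) _ _

/-- A random walk with two possible steps spreads out at polynomial speed. -/
theorem exists_expect_indicator_le (hρ : ∑' y, ρ y = 1) {v w : Lattice d} (hvw : v ≠ w)
    (hv : ρ v ≠ 0) (hw : ρ w ≠ 0) :
    ∃ C : ℕ, ∀ (K : ℕ) (A : Finset (Lattice d)) (x : Lattice d), A.card ≤ K →
      expect ρ (C * (K + 1) ^ 2) (fun l => if x + l.sum ∈ A then 1 else 0) ≤ 2⁻¹ := by
  obtain ⟨δ, hδ0, hδv, hδw⟩ : ∃ δ : ℝ≥0∞, δ ≠ 0 ∧ δ ≤ ρ v ∧ δ ≤ ρ w :=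
    ⟨min (ρ v) (ρ w), (lt_min (pos_iff_ne_zero.2 hv) (pos_iff_ne_zero.2 hw)).ne',
      min_le_left _ _, min_le_right _ _⟩
  obtain ⟨r, hr, h⟩ := transition_pow_indicator_le (ρ := ρ) hvw hδv hδw
  rw [hρ] at hr
  have hδt : δ ≠ ⊤ := by
    intro ht
    rw [ht] at hr
    simp at hr
  have hrt : r ≠ ⊤ := by
    intro ht
    rw [ht] at hr
    simp at hr
  lift δ to NNReal using hδt
  lift r to NNReal using hrt
  have hr' : (1 : ℝ) = r + 2 * δ := by exact_mod_cast hr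
  have hδ : (0 : ℝ) < δ := by
    have : δ ≠ 0 := by simpa using hδ0
    positivity
  have hr0 : (0 : ℝ) ≤ r := r.2
  obtain ⟨C, hC⟩ := exists_nat_ge (2 / (δ : ℝ))
  rw [div_le_iff₀ hδ] at hC
  refine ⟨C, fun K A x hA => ?_⟩
  rw [expect_sum _ (fun y => if y ∈ A then 1 else 0)]
  refine (h _ A x).trans ?_
  set m := C * (K + 1) ^ 2 with hm
  have hreal : (∑ i ∈ Finset.range (m + 1), (m.choose i : ℝ) * δ ^ i * r ^ (m - i) *
      (i.choose (i / 2) : ℝ)) * A.card ≤ 2⁻¹ := by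
    have hr2 : (r : ℝ) = 1 - 2 * δ := by linarith
    rw [hr2]
    have hK : (0 : ℝ) < K + 1 := by positivity
    -- With ε = 1/(2(K + 1)) and C ≥ 2/δ, both terms of the bound are at most 1/(4(K + 1)), so a set
    -- of at most K sites has probability at most 1/2.
    have h1 := sum_binomial_choose_half_le hδ (by linarith)
      (ε := (2 * (K + 1 : ℝ))⁻¹) (by positivity) m
    have h2 : (2 * (2 * (K + 1 : ℝ))⁻¹)⁻¹ * (2 * (δ : ℝ) * (m + 1))⁻¹ ≤ (4 * (K + 1 : ℝ))⁻¹ := by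
      rw [← mul_inv]
      refine inv_anti₀ (by positivity) ?_
      have hm' : (m : ℝ) = C * (K + 1) ^ 2 := by rw [hm]; push_cast; ring
      rw [hm']
      have : 2 * (K + 1 : ℝ) ^ 2 ≤ δ * (C * (K + 1) ^ 2 + 1) := by nlinarith [sq_nonneg (K + 1 : ℝ)]
      calc 4 * (K + 1 : ℝ) = 2 * (2 * (K + 1 : ℝ))⁻¹ * (2 * (2 * (K + 1) ^ 2)) := by
            field_simp
            norm_num
        _ ≤ 2 * (2 * (K + 1 : ℝ))⁻¹ * (2 * (δ * (C * (K + 1) ^ 2 + 1))) := by gcongr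
        _ = _ := by ring
    have h3 : (2 * (K + 1 : ℝ))⁻¹ / 2 + (4 * (K + 1 : ℝ))⁻¹ = 2⁻¹ * (K + 1 : ℝ)⁻¹ := by
      rw [mul_inv, mul_inv]; ring
    have hA' : (A.card : ℝ) ≤ K + 1 := by
      have : (A.card : ℝ) ≤ K := by exact_mod_cast hA
      linarith
    calc _ ≤ (2⁻¹ * (K + 1 : ℝ)⁻¹) * (K + 1) :=
          mul_le_mul (h1.trans (by linarith)) hA' (Nat.cast_nonneg _) (by positivity)
      _ = 2⁻¹ := by rw [mul_assoc, inv_mul_cancel₀ hK.ne', mul_one]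
  have hnn : (∑ i ∈ Finset.range (m + 1), (m.choose i : NNReal) * δ ^ i * r ^ (m - i) *
      (i.choose (i / 2) : NNReal)) * A.card ≤ 2⁻¹ := by exact_mod_cast hreal
  have := ENNReal.coe_le_coe.2 hnn
  push_cast at this
  exact this

end Convolution

end LocalConstraints

end

/-! ### Frequently visited sites and finiteness of the Green function -/

noncomputable section

namespace LocalConstraints

variable {d : ℕ} {ρ : Lattice d → ℝ≥0∞} {G : ℕ → ℝ≥0∞}

/-- The sites visited more than `h` times. -/
def frequent (h : ℕ) (M : List (Lattice d)) : Finset (Lattice d) :=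
  M.toFinset.filter fun x => h + 1 ≤ M.count x

theorem mem_frequent {h : ℕ} {M : List (Lattice d)} {x : Lattice d} :
    x ∈ frequent h M ↔ h + 1 ≤ M.count x := by
  rw [frequent, Finset.mem_filter, List.mem_toFinset, and_iff_right_iff_imp]
  intro hx
  exact List.count_pos_iff.1 (by omega)

theorem frequent_subset (h : ℕ) (s : Lattice d) (l l' : List (Lattice d)) :
    frequent h (sites s l) ⊆ frequent h (sites s (l ++ l')) := by
  intro x hx
  rw [mem_frequent] at hx ⊢
  rw [sites_append, List.count_append]
  omega

theorem allow_le_pow_frequent (h0 : G 0 = 1) (hG : Antitone G) (h : ℕ) (M : List (Lattice d)) :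
    allow G M ≤ G (h + 1) ^ (frequent h M).card := by
  rw [frequent, ← Finset.prod_const, Finset.prod_filter]
  refine Finset.prod_le_prod' fun x _ => ?_
  split_ifs with hx
  · exact hG hx
  · exact (hG (Nat.zero_le _)).trans h0.le

/-- The mean of a variable equal to θ ≤ 1 with probability a and to 1 otherwise decreases in a. -/
theorem mix_le {a b κ θ : ℝ≥0∞} (hab : a + b = 1) (hκ : κ ≤ a) (hθ : θ ≤ 1) :
    θ * a + b ≤ θ * κ + (1 - κ) := by
  obtain ⟨c, rfl⟩ := exists_add_of_le hκ
  have hκt : κ ≠ ⊤ := by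
    rintro rfl
    simp at hab
  have hc : c + b = 1 - κ := by
    rw [← hab, add_assoc, ENNReal.add_sub_cancel_left hκt]
  rw [mul_add, add_assoc, ← hc]
  gcongr
  exact mul_le_of_le_one_left' hθ

theorem mix_lt_one {κ θ : ℝ≥0∞} (hκ : κ ≠ 0) (hκ1 : κ ≤ 1) (hθ : θ < 1) :
    θ * κ + (1 - κ) < 1 := by
  have hκt : κ ≠ ⊤ := ne_top_of_le_ne_top ENNReal.one_ne_top hκ1
  calc θ * κ + (1 - κ) < 1 * κ + (1 - κ) :=
        ENNReal.add_lt_add_right (by simp) ((ENNReal.mul_lt_mul_iff_left hκ hκt).2 hθ)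
    _ = 1 := by rw [one_mul, add_tsub_cancel_of_le hκ1]

theorem pathProb_le_one (hρ : ∑' y, ρ y ≤ 1) (l : List (Lattice d)) : pathProb ρ l ≤ 1 := by
  have := pathProb_le_expect (ρ := ρ) l fun _ => 1
  rw [expect_one, mul_one] at this
  exact this.trans (pow_le_one₀ bot_le hρ)

theorem expect_le_const (hρ : ∑' y, ρ y = 1) {j : ℕ} {c : ℝ≥0∞} {F : List (Lattice d) → ℝ≥0∞}
    (h : ∀ l, l.length = j → F l ≤ c) : expect ρ j F ≤ c := by
  calc expect ρ j F ≤ expect ρ j fun _ => c * 1 := expect_mono fun l hl => by simpa using h l hl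
    _ = c := by rw [expect_const_mul, expect_one, hρ, one_pow, mul_one]

/-- The path that runs through the loop `O` exactly `k` times. -/
def loops (O : List (Lattice d)) (k : ℕ) : List (Lattice d) := (List.replicate k O).flatten

theorem loops_succ (O : List (Lattice d)) (k : ℕ) : loops O (k + 1) = O ++ loops O k := by
  simp [loops, List.replicate_succ]

theorem le_count_loops {O : List (Lattice d)} (hO : O ≠ []) (hs : O.sum = 0) (k : ℕ)
    (z : Lattice d) : k ≤ (sites z (loops O k)).count z := by
  induction k with
  | zero => simp
  | succ k ih =>
    rw [loops_succ, sites_append, List.count_append, hs, add_zero]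
    have : 1 ≤ (sites z O).count z := by
      rw [Nat.one_le_iff_ne_zero, ← Nat.pos_iff_ne_zero, List.count_pos_iff]
      simpa using mem_sites_prefix (s := z) (l := []) hO
    omega

theorem pathProb_loops (O : List (Lattice d)) (k : ℕ) :
    pathProb ρ (loops O k) = pathProb ρ O ^ k := by
  induction k with
  | zero => simp [loops]
  | succ k ih => rw [loops_succ, pathProb_append, ih, pow_succ']

theorem expect_ite_eq_le (hρ : ∑' y, ρ y = 1) (O : List (Lattice d)) {θ : ℝ≥0∞} (hθ : θ ≤ 1) :
    expect ρ O.length (fun l => if l = O then θ else 1) ≤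
      θ * pathProb ρ O + (1 - pathProb ρ O) := by
  have e : expect ρ O.length (fun l => if l = O then θ else 1) =
      θ * expect ρ O.length (fun l => if l = O then 1 else 0) +
        expect ρ O.length (fun l => if l = O then 0 else 1) := by
    rw [← expect_const_mul, ← expect_add]
    congr 1
    funext l
    split_ifs <;> simp
  rw [e]
  refine mix_le ?_ ?_ hθ
  · rw [← expect_add]
    have : (fun l : List (Lattice d) => ((if l = O then 1 else 0) + if l = O then 0 else 1 : ℝ≥0∞))
        = fun _ => 1 := by
      funext l
      split_ifs <;> simp
    rw [this, expect_one, hρ, one_pow]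
  · simpa using pathProb_le_expect (ρ := ρ) O fun l => if l = O then 1 else 0

theorem expect_ite_mem_le (hρ : ∑' y, ρ y = 1) (m : ℕ) (A : Finset (Lattice d)) (x : Lattice d)
    (h : expect ρ m (fun l => if x + l.sum ∈ A then 1 else 0) ≤ 2⁻¹) {θ : ℝ≥0∞} (hθ : θ ≤ 1) :
    expect ρ m (fun l => if x + l.sum ∈ A then 1 else θ) ≤ θ * 2⁻¹ + (1 - 2⁻¹) := by
  have e : expect ρ m (fun l => if x + l.sum ∈ A then 1 else θ) =
      θ * expect ρ m (fun l => if x + l.sum ∈ A then 0 else 1) +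
        expect ρ m (fun l => if x + l.sum ∈ A then 1 else 0) := by
    rw [← expect_const_mul, ← expect_add]
    congr 1
    funext l
    split_ifs <;> simp
  have e1 : expect ρ m (fun l => if x + l.sum ∈ A then 0 else 1) +
        expect ρ m (fun l => if x + l.sum ∈ A then 1 else 0) = 1 := by
    rw [← expect_add]
    have : (fun l : List (Lattice d) => ((if x + l.sum ∈ A then 0 else 1) +
        if x + l.sum ∈ A then 1 else 0 : ℝ≥0∞)) = fun _ => 1 := by
      funext l
      split_ifs <;> simp
    rw [this, expect_one, hρ, one_pow]
  rw [e]
  refine mix_le e1 ?_ hθ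
  by_contra hlt
  rw [not_le] at hlt
  have : expect ρ m (fun l => if x + l.sum ∈ A then 0 else 1) +
        expect ρ m (fun l => if x + l.sum ∈ A then 1 else 0) < 2⁻¹ + 2⁻¹ :=
    ENNReal.add_lt_add_of_lt_of_le (ne_top_of_le_ne_top (by simp) h) hlt h
  rw [e1, ENNReal.inv_two_add_inv_two] at this
  exact lt_irrefl _ this

/-- In a window of polynomial length a further site becomes frequent with positive probability. -/
theorem expect_frequent_window (hρ : ∑' y, ρ y = 1) {O : List (Lattice d)} (hO : O ≠ [])
    (hs : O.sum = 0) (h : ℕ) {θ : ℝ≥0∞} (hθ : θ ≤ 1) (l : List (Lattice d)) (m : ℕ)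
    (hm : expect ρ m (fun l' => if l.sum + l'.sum ∈ frequent h (sites 0 l) then 1 else 0) ≤ 2⁻¹) :
    expect ρ (m + (loops O (h + 1)).length)
        (fun l' => θ ^ (frequent h (sites 0 (l ++ l'))).card) ≤
      ((θ * pathProb ρ (loops O (h + 1)) + (1 - pathProb ρ (loops O (h + 1)))) * 2⁻¹ +
        (1 - 2⁻¹)) * θ ^ (frequent h (sites 0 l)).card := by
  set Q := loops O (h + 1)
  set θ₁ := θ * pathProb ρ Q + (1 - pathProb ρ Q)
  have hQ : pathProb ρ Q ≤ 1 := pathProb_le_one hρ.le Q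
  have hθ₁ : θ₁ ≤ 1 := by
    calc θ₁ ≤ 1 * pathProb ρ Q + (1 - pathProb ρ Q) :=
          add_le_add_left (mul_le_mul_left hθ _) _
      _ = 1 := by rw [one_mul, add_tsub_cancel_of_le hQ]
  rw [expect_append, mul_comm]
  -- The window has two stages: m steps to leave the frequent sites, with probability at least 1/2,
  -- then the loop run h + 1 times on the spot. The factor θ₁ bounds the gain of the second stage.
  refine le_trans (expect_mono (F' := fun l' => θ ^ (frequent h (sites 0 l)).card *
    if l.sum + l'.sum ∈ frequent h (sites 0 l) then 1 else θ₁) fun l' _ => ?_) ?_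
  · have hmono : ∀ l'', frequent h (sites 0 l) ⊆ frequent h (sites 0 (l ++ (l' ++ l''))) :=
      fun l'' => frequent_subset h 0 l (l' ++ l'')
    split_ifs with hA
    · rw [mul_one]
      exact expect_le_const hρ fun l'' _ =>
        pow_le_pow_right_of_le_one' hθ (Finset.card_le_card (hmono l''))
    · refine le_trans (expect_mono (F' := fun l'' => θ ^ (frequent h (sites 0 l)).card *
        if l'' = Q then θ else 1) fun l'' _ => ?_) ?_
      · split_ifs with hl
        · subst hl
          rw [← pow_succ]
          refine pow_le_pow_right_of_le_one' hθ ?_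
          -- The site reached after the m steps was not frequent, and the loops visit it h + 1
          -- times.
          rw [← Finset.card_insert_of_notMem hA]
          refine Finset.card_le_card (Finset.insert_subset ?_ (hmono _))
          rw [mem_frequent, ← List.append_assoc, sites_append, List.count_append,
            List.sum_append, zero_add]
          exact (le_count_loops hO hs (h + 1) _).trans (Nat.le_add_left _ _)
        · rw [mul_one]
          exact pow_le_pow_right_of_le_one' hθ (Finset.card_le_card (hmono l''))
      · rw [expect_const_mul]
        gcongr
        exact expect_ite_eq_le hρ Q hθ
  · rw [expect_const_mul]
    gcongr
    exact expect_ite_mem_le hρ m _ _ hm hθ₁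

/-- The generating function of the number of frequent sites after `j` steps. -/
def frequentGen (ρ : Lattice d → ℝ≥0∞) (h : ℕ) (θ : ℝ≥0∞) (j : ℕ) : ℝ≥0∞ :=
  expect ρ j fun l => θ ^ (frequent h (sites 0 l)).card

theorem frequentGen_antitone (hρ : ∑' y, ρ y = 1) (h : ℕ) {θ : ℝ≥0∞} (hθ : θ ≤ 1) :
    Antitone (frequentGen ρ h θ) := by
  refine antitone_nat_of_succ_le fun j => ?_
  rw [frequentGen, expect_append]
  refine expect_mono fun l _ => expect_le_const hρ fun l' _ => ?_
  exact pow_le_pow_right_of_le_one' hθ (Finset.card_le_card (frequent_subset h 0 l l'))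

/-- Either at most K sites are frequent, and a window of length of order K² contracts by a factor θ'
independent of K; or there are more, and their contribution is at most θ^(K+1) already. -/
theorem frequentGen_step (hρ : ∑' y, ρ y = 1) {O : List (Lattice d)} (hO : O ≠ [])
    (hs : O.sum = 0) (hp : pathProb ρ O ≠ 0) {v w : Lattice d} (hvw : v ≠ w)
    (hv : ρ v ≠ 0) (hw : ρ w ≠ 0) (h : ℕ) {θ : ℝ≥0∞} (hθ : θ < 1) :
    ∃ θ' : ℝ≥0∞, θ' < 1 ∧ ∃ C B : ℕ, 1 ≤ B ∧ ∀ K j : ℕ,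
      frequentGen ρ h θ (j + (C * (K + 1) ^ 2 + B)) ≤
        θ' * frequentGen ρ h θ j + θ ^ (K + 1) := by
  obtain ⟨C, hC⟩ := exists_expect_indicator_le hρ hvw hv hw
  have hQ : pathProb ρ (loops O (h + 1)) ≤ 1 := pathProb_le_one hρ.le _
  have hQ0 : pathProb ρ (loops O (h + 1)) ≠ 0 := by
    rw [pathProb_loops]
    exact pow_ne_zero _ hp
  refine ⟨_, mix_lt_one (κ := 2⁻¹) (by simp) (by simp) (mix_lt_one hQ0 hQ hθ), C,
    (loops O (h + 1)).length, ?_, fun K j => ?_⟩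
  · rw [loops_succ, List.length_append]
    have := List.length_pos_iff.2 hO
    omega
  · rw [frequentGen, frequentGen, expect_append, ← expect_const_mul]
    set c := (θ * pathProb ρ (loops O (h + 1)) + (1 - pathProb ρ (loops O (h + 1)))) * 2⁻¹ +
      (1 - 2⁻¹)
    refine le_trans (expect_mono (F' := fun l => c * θ ^ (frequent h (sites 0 l)).card +
      θ ^ (K + 1) * 1) fun l _ => ?_) ?_
    · by_cases hK : (frequent h (sites 0 l)).card ≤ K
      · exact (expect_frequent_window hρ hO hs h hθ.le l _ (hC K _ _ hK)).trans le_self_add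
      · rw [mul_one]
        refine le_trans (expect_le_const hρ fun l' _ => ?_) le_add_self
        refine pow_le_pow_right_of_le_one' hθ.le ?_
        have := Finset.card_le_card (frequent_subset h 0 l l')
        omega
    · rw [expect_add, expect_const_mul (θ ^ (K + 1)), expect_one, hρ, one_pow, mul_one]

/-- An index j is charged to a block with J K ≤ j < J (K + 1), and the length of the block is
bounded crudely by J (K + 1). -/
theorem tsum_le_of_antitone {b : ℕ → ℝ≥0∞} (hb : Antitone b) {J : ℕ → ℕ} (h0 : J 0 = 0)
    (hJ : ∀ K, K ≤ J K) : ∑' j, b j ≤ ∑' K, (J (K + 1) : ℝ≥0∞) * b (J K) := by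
  have e : ∑' K, (J (K + 1) : ℝ≥0∞) * b (J K) =
      ∑' x : ℕ × ℕ, if x.2 < J (x.1 + 1) then b (J x.1) else 0 := by
    rw [ENNReal.tsum_prod']
    refine tsum_congr fun K => ?_
    rw [tsum_eq_sum (s := Finset.range (J (K + 1)))]
    · rw [Finset.sum_congr rfl (g := fun _ => b (J K))]
      · simp
      · intro i hi
        rw [if_pos (by simpa using hi)]
    · intro i hi
      rw [if_neg (by simpa using hi)]
  rw [e]
  refine tsum_le_tsum_of_rel (fun j x => x.2 = j) (fun j _ => ?_) fun j j' x _ _ h h' =>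
    h.symm.trans h'
  have hex : ∃ K, j < J K := ⟨j + 1, (hJ (j + 1))⟩
  have hspec := Nat.find_spec hex
  have hmin := fun i => Nat.find_min (m := i) hex
  generalize Nat.find hex = K at hspec hmin
  cases K with
  | zero => omega
  | succ K =>
    refine ⟨(K, j), rfl, ?_⟩
    dsimp only
    rw [if_pos hspec]
    exact hb (not_lt.1 (hmin K (Nat.lt_succ_self K)))

theorem tsum_poly_geometric_ne_top {r : ℝ≥0∞} (hr : r < 1) (C B : ℕ) :
    ∑' K : ℕ, (((K + 1) * (C * (K + 1 + 1) ^ 2 + B) : ℕ) : ℝ≥0∞) * ((K + 1 : ℕ) * r ^ K) ≠ ⊤ := by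
  obtain ⟨t, hrt, ht⟩ := ENNReal.lt_iff_exists_nnreal_btwn.1 hr
  have ht1 : (t : ℝ) < 1 := by exact_mod_cast ht
  have ht0 : (0 : ℝ) < t := by
    have : (0 : ℝ≥0∞) < t := bot_le.trans_lt hrt
    exact_mod_cast this
  -- The polynomial factor has degree 4: degree 3 from the block length, one more from K + 1.
  have hsum : Summable fun n : ℕ => ((n : ℝ)) ^ 4 * (t : ℝ) ^ n :=
    summable_pow_mul_geometric_of_norm_lt_one 4 (by simpa using ht1)
  have hsum2 := ((hsum.comp_injective (add_left_injective 2)).mul_left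
    (((C : ℝ) + B) * ((t : ℝ) ^ 2)⁻¹))
  refine ne_top_of_le_ne_top hsum2.tsum_ofReal_ne_top (ENNReal.tsum_le_tsum fun K => ?_)
  have h1 : (((K + 1) * (C * (K + 1 + 1) ^ 2 + B) : ℕ) : ℝ≥0∞) * ((K + 1 : ℕ) * r ^ K) ≤
      ENNReal.ofReal ((((K + 1) * (C * (K + 1 + 1) ^ 2 + B) : ℕ) : ℝ) *
        ((K + 1 : ℕ) * (t : ℝ) ^ K)) := by
    rw [ENNReal.ofReal_mul (Nat.cast_nonneg _), ENNReal.ofReal_natCast,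
      ENNReal.ofReal_mul (Nat.cast_nonneg _), ENNReal.ofReal_natCast,
      ENNReal.ofReal_pow ht0.le, ENNReal.ofReal_coe_nnreal]
    gcongr
  refine h1.trans (ENNReal.ofReal_le_ofReal ?_)
  simp only [Function.comp_apply]
  have h2 : (K + 1) * (C * (K + 1 + 1) ^ 2 + B) * (K + 1) ≤ (C + B) * (K + 2) ^ 4 := by
    calc (K + 1) * (C * (K + 1 + 1) ^ 2 + B) * (K + 1)
        ≤ (K + 2) * (C * (K + 2) ^ 2 + B * (K + 2) ^ 2) * (K + 2) := by
          gcongr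
          · omega
          · exact Nat.le_mul_of_pos_right _ (by positivity)
          · omega
      _ = _ := by ring
  have h3 : (((K + 1) * (C * (K + 1 + 1) ^ 2 + B) : ℕ) : ℝ) * ((K + 1 : ℕ) : ℝ) ≤
      ((C : ℝ) + B) * ((K + 2 : ℕ) : ℝ) ^ 4 := by exact_mod_cast h2
  calc _ = (((K + 1) * (C * (K + 1 + 1) ^ 2 + B) : ℕ) : ℝ) * ((K + 1 : ℕ) : ℝ) * (t : ℝ) ^ K := by
        ring
    _ ≤ ((C : ℝ) + B) * ((K + 2 : ℕ) : ℝ) ^ 4 * (t : ℝ) ^ K := by gcongr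
    _ = _ := by
      rw [pow_add]
      field_simp

/-- Running K windows of the size adapted to K takes time `J K`, cubic in K, and brings the
generating function below (K + 1) max(θ', θ)^K. By monotonicity these times control the whole sum.
-/
theorem tsum_frequentGen_ne_top (hρ : ∑' y, ρ y = 1) {O : List (Lattice d)} (hO : O ≠ [])
    (hs : O.sum = 0) (hp : pathProb ρ O ≠ 0) {v w : Lattice d} (hvw : v ≠ w)
    (hv : ρ v ≠ 0) (hw : ρ w ≠ 0) (h : ℕ) {θ : ℝ≥0∞} (hθ : θ < 1) :
    ∑' j, frequentGen ρ h θ j ≠ ⊤ := by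
  obtain ⟨θ', hθ', C, B, hB, hstep⟩ := frequentGen_step hρ hO hs hp hvw hv hw h hθ
  set J : ℕ → ℕ := fun K => K * (C * (K + 1) ^ 2 + B)
  have hiter : ∀ K i : ℕ, frequentGen ρ h θ (i * (C * (K + 1) ^ 2 + B)) ≤
      θ' ^ i + i * θ ^ (K + 1) := by
    intro K i
    induction i with
    | zero => simp [frequentGen, expect, frequent]
    | succ i ih =>
      rw [Nat.succ_mul]
      refine (hstep K _).trans ?_
      calc _ ≤ θ' * (θ' ^ i + i * θ ^ (K + 1)) + θ ^ (K + 1) := by gcongr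
        _ ≤ θ' ^ (i + 1) + 1 * (i * θ ^ (K + 1)) + θ ^ (K + 1) := by
          rw [mul_add, pow_succ' θ' i]
          gcongr
        _ = _ := by push_cast; ring
  refine ne_top_of_le_ne_top (tsum_poly_geometric_ne_top (max_lt hθ' hθ) C B)
    ((tsum_le_of_antitone (frequentGen_antitone hρ h hθ.le) (J := J) (by simp [J])
      fun K => Nat.le_mul_of_pos_right _ (by omega)).trans (ENNReal.tsum_le_tsum fun K => ?_))
  gcongr
  refine (hiter K K).trans ?_
  have hθK : θ ^ (K + 1) ≤ max θ' θ ^ K :=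
    (pow_le_pow_right_of_le_one' hθ.le (Nat.le_succ K)).trans
      (pow_le_pow_left₀ bot_le (le_max_right _ _) K)
  calc θ' ^ K + K * θ ^ (K + 1) ≤ max θ' θ ^ K + K * max θ' θ ^ K :=
        add_le_add (pow_le_pow_left₀ bot_le (le_max_left _ _) K) (mul_le_mul_right hθK _)
    _ = _ := by push_cast; ring

theorem expect_replicate (hρ : ∀ y, y ≠ 0 → ρ y = 0) (h1 : ρ 0 = 1) (j : ℕ)
    (F : List (Lattice d) → ℝ≥0∞) : expect ρ j F = F (List.replicate j 0) := by
  induction j generalizing F with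
  | zero => rfl
  | succ j ih =>
    rw [expect, tsum_eq_single 0 fun y hy => by rw [hρ y hy, zero_mul], h1, one_mul, ih]
    rfl

theorem sites_replicate_zero (j : ℕ) :
    sites (0 : Lattice d) (List.replicate j 0) = List.replicate j 0 := by
  induction j with
  | zero => rfl
  | succ j ih => rw [List.replicate_succ, sites_cons, add_zero, ih]

/-- The constrained induced walk makes finitely many steps on average. -/
theorem tsum_expect_allow_ne_top (h0 : G 0 = 1) (hG : Antitone G) (hρ : ∑' y, ρ y ≤ 1)
    (hloop : ∑' y, ρ y = 1 → ∃ O : List (Lattice d), O ≠ [] ∧ O.sum = 0 ∧ pathProb ρ O ≠ 0)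
    (hfin : ∑' y, ρ y = 1 → ∃ h, G (h + 1) < 1)
    (hmean : ρ 0 = 1 → ∑' j, G j ≠ ⊤) :
    ∑' j, expect ρ j (fun l => allow G (sites 0 l)) ≠ ⊤ := by
  rcases hρ.lt_or_eq with hlt | heq
  · refine ne_top_of_le_ne_top (b := ∑' j, (∑' y, ρ y) ^ j) ?_ (ENNReal.tsum_le_tsum fun j => ?_)
    · rw [ENNReal.tsum_geometric]
      exact ENNReal.inv_ne_top.2 (tsub_pos_of_lt hlt).ne'
    · rw [← expect_one]
      exact expect_mono fun l _ => allow_le_one h0 hG _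
  · by_cases hv : ∃ v, v ≠ 0 ∧ ρ v ≠ 0
    · obtain ⟨v, hv0, hv⟩ := hv
      obtain ⟨O, hO, hs, hp⟩ := hloop heq
      obtain ⟨h, hh⟩ := hfin heq
      -- A loop cannot use the nonzero step v alone, so it supplies the second possible step.
      obtain ⟨w, hwO, hwv⟩ : ∃ w ∈ O, w ≠ v := by
        by_contra! hall
        rw [List.sum_eq_card_nsmul O v hall] at hs
        have := List.length_pos_iff.2 hO
        rcases smul_eq_zero.1 hs with h1 | h1
        · omega
        · exact hv0 h1
      refine ne_top_of_le_ne_top (tsum_frequentGen_ne_top heq hO hs hp hwv.symm hv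
        (apply_ne_zero_of_pathProb hp hwO) h hh) (ENNReal.tsum_le_tsum fun j => ?_)
      exact expect_mono fun l _ => allow_le_pow_frequent h0 hG h _
    · push Not at hv
      have h1 : ρ 0 = 1 := by
        rw [← heq, tsum_eq_single 0 hv]
      -- The induced walk never moves: j steps are j visits to the origin, of weight G j.
      refine ne_top_of_le_ne_top (hmean h1) (ENNReal.tsum_le_tsum fun j => ?_)
      rw [expect_replicate hv h1, sites_replicate_zero]
      cases j with
      | zero => simp [h0]
      | succ j =>
        rw [allow, List.toFinset_replicate_of_ne_zero (Nat.succ_ne_zero j), Finset.prod_singleton,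
          List.count_replicate_self]

end LocalConstraints

end

/-! ### Renewal sequences and geometric rates -/

noncomputable section

namespace LocalConstraints

section Renewal

open Filter Topology

/-- A renewal sequence that stays away from `0` belongs to a proper positive recurrent law. -/
theorem hasSum_of_renewal {a g : ℕ → ℝ} {c : ℝ} (hc : 0 < c) (ha : ∀ n, c ≤ a n)
    (ha1 : ∀ n, a n ≤ 1) (ha0 : a 0 = 1) (hg : ∀ k, 0 ≤ g k)
    (hren : ∀ n, a (n + 1) = ∑ k ∈ Finset.range (n + 1), g k * a (n - k)) :
    HasSum g 1 ∧ ∃ m, 1 ≤ m ∧ HasSum (fun k : ℕ => ((k + 1 : ℕ) : ℝ) * g k) m := by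
  set t : ℕ → ℝ := fun i => 1 - ∑ k ∈ Finset.range i, g k with ht
  have ht0 : t 0 = 1 := by simp [ht]
  have hts : ∀ i, t (i + 1) = t i - g i := by
    intro i
    simp only [ht, Finset.sum_range_succ]
    ring
  have hta : Antitone t := antitone_nat_of_succ_le fun i => by
    rw [hts]
    linarith [hg i]
  -- Decomposition according to the last renewal up to time n; `t i` plays the tail of the renewal
  -- law.
  have hid : ∀ n, ∑ i ∈ Finset.range (n + 1), a (n - i) * t i = 1 := by
    intro n
    induction n with
    | zero => simp [ha0, ht0]
    | succ n ih =>
      rw [Finset.sum_range_succ', Nat.sub_zero, ht0, mul_one, hren n, ← Finset.sum_add_distrib,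
        ← ih]
      refine Finset.sum_congr rfl fun i _ => ?_
      rw [Nat.add_sub_add_right, hts]
      ring
  -- That the weights sum to at most 1 is not assumed. A negative `t i₀` would stay negative, and
  -- since a ≥ c the sum in `hid` would drop below 1.
  have hnn : ∀ i, 0 ≤ t i := by
    intro i₀
    by_contra! hneg
    have hbound : ∀ m : ℕ, 1 ≤ (i₀ : ℝ) + m * (c * t i₀) := by
      intro m
      rcases Nat.eq_zero_or_pos m with rfl | hm
      · have : i₀ ≠ 0 := by
          rintro rfl
          rw [ht0] at hneg
          linarith
        have : 1 ≤ i₀ := Nat.one_le_iff_ne_zero.2 this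
        simpa using this
      · have h := hid (i₀ + m - 1)
        rw [Nat.sub_add_cancel (by omega), Finset.sum_range_add] at h
        rw [← h]
        refine add_le_add ?_ ?_
        · calc _ ≤ ∑ _i ∈ Finset.range i₀, (1 : ℝ) := by
                refine Finset.sum_le_sum fun i _ => ?_
                have h1 : t i ≤ 1 := ht0 ▸ hta (Nat.zero_le i)
                have h2 := ha (i₀ + m - 1 - i)
                have h3 := ha1 (i₀ + m - 1 - i)
                nlinarith
            _ = i₀ := by simp
        · calc _ ≤ ∑ _i ∈ Finset.range m, c * t i₀ := by
                refine Finset.sum_le_sum fun i _ => ?_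
                have h1 : t (i₀ + i) ≤ t i₀ := hta (Nat.le_add_right _ _)
                have h2 := ha (i₀ + m - 1 - (i₀ + i))
                nlinarith
            _ = m * (c * t i₀) := by simp
    obtain ⟨m, hm⟩ := exists_nat_gt ((i₀ : ℝ) / (-(c * t i₀)))
    have hpos : 0 < -(c * t i₀) := by nlinarith
    rw [div_lt_iff₀ hpos] at hm
    linarith [hbound m]
  have hsum : ∀ n, ∑ i ∈ Finset.range n, t i ≤ c⁻¹ := by
    intro n
    have h1 : c * ∑ i ∈ Finset.range (n + 1), t i ≤ 1 := by
      rw [← hid n, Finset.mul_sum]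
      exact Finset.sum_le_sum fun i _ => mul_le_mul_of_nonneg_right (ha _) (hnn i)
    have h2 : ∑ i ∈ Finset.range n, t i ≤ ∑ i ∈ Finset.range (n + 1), t i := by
      rw [Finset.sum_range_succ]
      linarith [hnn n]
    refine h2.trans ?_
    rw [← one_div, le_div_iff₀ hc]
    linarith
  have hlim : Tendsto t atTop (𝓝 0) :=
    (summable_of_sum_range_le hnn hsum).tendsto_atTop_zero
  have hG : HasSum g 1 := by
    rw [hasSum_iff_tendsto_nat_of_nonneg hg]
    have := hlim.const_sub 1
    simpa [ht] using this
  refine ⟨hG, ?_⟩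
  -- Summation by parts: the mean is bounded by the sum of the tails.
  have hmean : ∀ n, ∑ k ∈ Finset.range n, ((k + 1 : ℕ) : ℝ) * g k =
      ∑ i ∈ Finset.range n, t i - n * t n := by
    intro n
    induction n with
    | zero => simp
    | succ n ih =>
      rw [Finset.sum_range_succ, ih, Finset.sum_range_succ, hts]
      push_cast
      ring
  have hS : Summable fun k : ℕ => ((k + 1 : ℕ) : ℝ) * g k := by
    refine summable_of_sum_range_le (c := c⁻¹) (fun k => mul_nonneg (Nat.cast_nonneg _) (hg k))
      fun n => ?_
    rw [hmean]
    have : 0 ≤ (n : ℝ) * t n := mul_nonneg (Nat.cast_nonneg _) (hnn n)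
    linarith [hsum n]
  refine ⟨_, hasSum_le (fun k => ?_) hG hS.hasSum, hS.hasSum⟩
  have : (1 : ℝ) ≤ ((k + 1 : ℕ) : ℝ) := by exact_mod_cast Nat.le_add_left 1 k
  nlinarith [hg k]

/-- A sequence that is both super- and, up to a constant, submultiplicative is comparable to a
geometric sequence. -/
theorem exists_geometric_rate {u : ℕ → ℝ} {C : ℝ} (h0 : u 0 = 1) (hpos : ∀ n, 0 < u n)
    (h1 : ∀ n, u n ≤ 1) (hC : 1 ≤ C) (hsup : ∀ a b, u a * u b ≤ u (a + b))
    (hsub : ∀ a b, u (a + b) ≤ C * u a * u b) :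
    ∃ q : ℝ, 0 < q ∧ q ≤ 1 ∧ (∀ n, u n ≤ q ^ n) ∧ ∀ n, q ^ n ≤ C * u n := by
  have hlow : ∀ m n, u m ^ n ≤ u (m * n) := by
    intro m n
    induction n with
    | zero => simp [h0]
    | succ n ih =>
      rw [pow_succ, Nat.mul_succ]
      exact (mul_le_mul_of_nonneg_right ih (hpos m).le).trans (hsup _ _)
  have hup : ∀ n m, u (m * n) ≤ (C * u n) ^ m := by
    intro n m
    induction m with
    | zero => simp [h0]
    | succ m ih =>
      rw [Nat.succ_mul]
      calc u (m * n + n) ≤ C * u (m * n) * u n := hsub _ _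
        _ ≤ C * (C * u n) ^ m * u n := by
          have := (hpos n).le
          gcongr
        _ = _ := by ring
  have hCu : ∀ n, 0 ≤ C * u n := fun n => mul_nonneg (by linarith) (hpos n).le
  -- The rate will be `sSup S`, the supremum of the m-th roots of u m.
  set S : Set ℝ := {x | 0 ≤ x ∧ ∃ m, m ≠ 0 ∧ x ^ m ≤ u m} with hS
  have hSle : ∀ x ∈ S, ∀ n, x ^ n ≤ C * u n := by
    rintro x ⟨hx, m, hm, hxm⟩ n
    -- Compare at the common index m n: x^(mn) ≤ (u m)^n ≤ u (mn) ≤ (C u n)^m.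
    rw [← pow_le_pow_iff_left₀ (pow_nonneg hx n) (hCu n) hm]
    calc (x ^ n) ^ m = (x ^ m) ^ n := by rw [← pow_mul, ← pow_mul, mul_comm]
      _ ≤ u m ^ n := by gcongr
      _ ≤ _ := (hlow m n).trans (hup n m)
  have hS1 : ∀ x ∈ S, x ≤ 1 := by
    rintro x ⟨hx, m, hm, hxm⟩
    exact (pow_le_one_iff_of_nonneg hx hm).1 (hxm.trans (h1 m))
  have hbdd : BddAbove S := ⟨1, hS1⟩
  have hu1 : u 1 ∈ S := ⟨(hpos 1).le, 1, one_ne_zero, by simp⟩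
  have hroot : ∀ {y : ℝ} {n : ℕ}, 0 ≤ y → n ≠ 0 → (y ^ ((n : ℝ)⁻¹)) ^ n = y :=
    fun hy hn => Real.rpow_inv_natCast_pow hy hn
  refine ⟨sSup S, (hpos 1).trans_le (le_csSup hbdd hu1), csSup_le ⟨_, hu1⟩ hS1, fun n => ?_,
    fun n => ?_⟩
  · rcases eq_or_ne n 0 with rfl | hn
    · simp [h0]
    · have hmem : u n ^ ((n : ℝ)⁻¹) ∈ S :=
        ⟨Real.rpow_nonneg (hpos n).le _, n, hn, (hroot (hpos n).le hn).le⟩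
      calc u n = (u n ^ ((n : ℝ)⁻¹)) ^ n := (hroot (hpos n).le hn).symm
        _ ≤ _ := pow_le_pow_left₀ (Real.rpow_nonneg (hpos n).le _) (le_csSup hbdd hmem) n
  · rcases eq_or_ne n 0 with rfl | hn
    · simpa [h0] using hC
    · have hle : sSup S ≤ (C * u n) ^ ((n : ℝ)⁻¹) := by
        refine csSup_le ⟨_, hu1⟩ fun x hx => ?_
        rw [← pow_le_pow_iff_left₀ hx.1 (Real.rpow_nonneg (hCu n) _) hn, hroot (hCu n) hn]
        exact hSle x hx n
      calc sSup S ^ n ≤ ((C * u n) ^ ((n : ℝ)⁻¹)) ^ n :=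
            pow_le_pow_left₀ ((hpos 1).le.trans (le_csSup hbdd hu1)) hle n
        _ = _ := hroot (hCu n) hn

/-- Supermultiplicativity follows from the renewal equation by strong induction. Dividing by q^n
then gives a renewal sequence with values in [1/C, 1]. -/
theorem exists_renewal_rate {u f : ℕ → ℝ} {C : ℝ} (h0 : u 0 = 1) (hpos : 0 < u 1)
    (hu : ∀ n, 0 ≤ u n) (h1 : ∀ n, u n ≤ 1) (hf : ∀ k, 0 ≤ f k)
    (hsub : ∀ a b, u (a + b) ≤ C * u a * u b)
    (hren : ∀ n, u (n + 1) = ∑ k ∈ Finset.range (n + 1), f (k + 1) * u (n - k)) :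
    ∃ q : ℝ, 0 < q ∧ q ≤ 1 ∧ (∀ n, u n ≤ q ^ n) ∧ (∀ n, q ^ n ≤ C * u n) ∧
      HasSum (fun k : ℕ => f (k + 1) / q ^ (k + 1)) 1 ∧
      ∃ m : ℝ, 1 ≤ m ∧ HasSum (fun k : ℕ => ((k + 1 : ℕ) : ℝ) * f (k + 1) / q ^ (k + 1)) m := by
  have hsup : ∀ a b, u a * u b ≤ u (a + b) := by
    intro a
    induction a using Nat.strong_induction_on with
    | _ a ih =>
      intro b
      cases a with
      | zero => simp [h0]
      | succ a =>
        rw [hren a, Finset.sum_mul, Nat.add_right_comm, hren (a + b)]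
        refine (Finset.sum_le_sum (g := fun k => f (k + 1) * u (a + b - k)) fun k hk => ?_).trans
          (Finset.sum_le_sum_of_subset_of_nonneg ?_ fun k _ _ => mul_nonneg (hf _) (hu _))
        · have hk : k ≤ a := by simpa [Nat.lt_succ_iff] using hk
          rw [mul_assoc]
          refine mul_le_mul_of_nonneg_left ?_ (hf _)
          have := ih (a - k) (by omega) b
          rwa [show a - k + b = a + b - k by omega] at this
        · intro k hk
          simp only [Finset.mem_range] at hk ⊢
          omega
  have hposn : ∀ n, 0 < u n := by
    intro n
    induction n with
    | zero => simp [h0]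
    | succ n ih => exact (mul_pos ih hpos).trans_le (hsup n 1)
  have hC : 1 ≤ C := by simpa [h0] using hsub 0 0
  obtain ⟨q, hq0, hq1, hqu, hqC⟩ := exists_geometric_rate h0 hposn h1 hC hsup hsub
  refine ⟨q, hq0, hq1, hqu, hqC, ?_⟩
  have hC0 : 0 < C := by linarith
  have := hasSum_of_renewal (a := fun n => u n / q ^ n) (g := fun k => f (k + 1) / q ^ (k + 1))
    (c := C⁻¹) (inv_pos.2 hC0) (fun n => ?_) (fun n => ?_) (by simp [h0])
    (fun k => div_nonneg (hf _) (pow_pos hq0 _).le) (fun n => ?_)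
  · obtain ⟨h2, m, hm, h3⟩ := this
    exact ⟨h2, m, hm, by simpa only [mul_div_assoc] using h3⟩
  · rw [le_div_iff₀ (pow_pos hq0 n), inv_mul_le_iff₀ hC0]
    exact hqC n
  · rw [div_le_one (pow_pos hq0 n)]
    exact hqu n
  · rw [hren n, Finset.sum_div]
    refine Finset.sum_congr rfl fun k hk => ?_
    have hk : k ≤ n := by simpa [Nat.lt_succ_iff] using hk
    rw [div_mul_div_comm, ← pow_add, show k + 1 + (n - k) = n + 1 by omega]

end Renewal

end LocalConstraints

end

/-! ### Translation from infinite paths to lists of steps -/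

noncomputable section

namespace LocalConstraints

section FirstTime

theorem firstTime_eq {p : ℕ → Prop} {t : ℕ} (ht : p t) (hmin : ∀ j < t, ¬ p j) :
    firstTime p = t := by
  refine le_antisymm (iInf₂_le t ht) (le_iInf₂ fun j hj => ?_)
  by_contra h
  rw [not_le, Nat.cast_lt] at h
  exact hmin j h hj

theorem exists_of_firstTime_lt_top {p : ℕ → Prop} (h : firstTime p < ⊤) :
    ∃ t : ℕ, firstTime p = t ∧ p t ∧ ∀ j < t, ¬ p j := by
  classical
  have hex : ∃ t, p t := by
    by_contra! hn
    simp [firstTime, hn] at h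
  exact ⟨Nat.find hex, firstTime_eq (Nat.find_spec hex) fun j hj => Nat.find_min hex hj,
    Nat.find_spec hex, fun j hj => Nat.find_min hex hj⟩

theorem coe_lt_firstTime {p : ℕ → Prop} {t : ℕ} :
    (t : ℕ∞) < firstTime p ↔ ∀ j ≤ t, ¬ p j := by
  constructor
  · intro h j hj hp
    have h1 : firstTime p ≤ (j : ℕ∞) := iInf₂_le j hp
    have h2 : (j : ℕ∞) ≤ t := by exact_mod_cast hj
    exact absurd h (not_lt.2 (h1.trans h2))
  · intro h
    by_cases htop : firstTime p < ⊤
    · obtain ⟨i, hi, hp, -⟩ := exists_of_firstTime_lt_top htop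
      rw [hi]
      by_contra hn
      rw [not_lt, Nat.cast_le] at hn
      exact h i hn hp
    · rw [not_lt_top_iff.1 htop]
      exact ENat.natCast_lt_top t

end FirstTime

variable {d : ℕ}

/-- The first `t` steps. -/
def steps (ξ : ℕ → Lattice d) (t : ℕ) : List (Lattice d) := (List.range t).map ξ

theorem steps_sum (ξ : ℕ → Lattice d) (t : ℕ) :
    (steps ξ t).sum = ∑ j ∈ Finset.range t, ξ j := by
  induction t with
  | zero => simp [steps]
  | succ t ih =>
    rw [Finset.sum_range_succ, ← ih]
    simp [steps, List.range_succ]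

theorem walk_eq (s : Lattice d) (ξ : ℕ → Lattice d) (t : ℕ) :
    walk s ξ t = s + (steps ξ t).sum := by rw [walk, steps_sum]

@[simp] theorem steps_length (ξ : ℕ → Lattice d) (t : ℕ) : (steps ξ t).length = t := by
  simp [steps]

theorem steps_add (ξ : ℕ → Lattice d) (a b : ℕ) :
    steps ξ (a + b) = steps ξ a ++ steps (fun j => ξ (a + j)) b := by
  simp [steps, List.range_add, Function.comp_def]

theorem walk_add (s : Lattice d) (ξ : ℕ → Lattice d) (a b : ℕ) :
    walk s ξ (a + b) = walk (s + (steps ξ a).sum) (fun j => ξ (a + j)) b := by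
  rw [walk_eq, walk_eq, steps_add, List.sum_append, add_assoc]

theorem sites_steps (s : Lattice d) (ξ : ℕ → Lattice d) (t : ℕ) :
    sites s (steps ξ t) = (List.range t).map (walk s ξ) := by
  induction t with
  | zero => simp [steps]
  | succ t ih =>
    have h : steps ξ (t + 1) = steps ξ t ++ [ξ t] := by simp [steps, List.range_succ]
    rw [h, sites_append, ih, List.range_succ, List.map_append, walk_eq s ξ t |>.symm]
    rfl

theorem mem_sites_steps {s x : Lattice d} {ξ : ℕ → Lattice d} {t : ℕ} :
    x ∈ sites s (steps ξ t) ↔ ∃ j < t, walk s ξ j = x := by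
  simp [sites_steps]

theorem count_sites_steps (s x : Lattice d) (ξ : ℕ → Lattice d) (t : ℕ) :
    (sites s (steps ξ t)).count x =
      ((Finset.range t).filter fun j => walk s ξ j = x).card := by
  induction t with
  | zero => simp [steps]
  | succ t ih =>
    rw [sites_steps, List.range_succ, List.map_append, List.count_append, ← sites_steps, ih,
      Finset.range_add_one, Finset.filter_insert]
    by_cases h : walk s ξ t = x
    · simp [h]
    · simp [h]

/-- Survival at the last visit to x before time t already bounds the number of all earlier visits.
-/
theorem card_visits_le {y : ℕ → Lattice d} {t : ℕ} {h : Lattice d → ℕ∞}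
    (hr : ∀ j ≤ t, (localTime y j (y j) : ℕ∞) ≤ h (y j)) (x : Lattice d) :
    ((((Finset.range t).filter fun j => y j = x).card : ℕ) : ℕ∞) ≤ h x := by
  set V := (Finset.range t).filter fun j => y j = x
  rcases V.eq_empty_or_nonempty with hV | hV
  · simp [hV]
  · have hmem := V.max'_mem hV
    set j := V.max' hV
    obtain ⟨hjt, hjx⟩ := Finset.mem_filter.1 hmem
    have h1 := hr j (Finset.mem_range.1 hjt).le
    rw [hjx] at h1
    refine le_trans ?_ h1
    unfold localTime
    norm_cast
    refine Finset.card_le_card fun i hi => ?_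
    have h2 := V.le_max' i hi
    have h3 := Finset.mem_filter.1 hi
    exact Finset.mem_filter.2 ⟨Finset.mem_range.2 (Nat.lt_succ_of_le h2), h3.2⟩

variable [NeZero d]

theorem firstPassage_steps {s : Lattice d} {n : ℤ} {ξ : ℕ → Lattice d} {t : ℕ} :
    FirstPassage s n (steps ξ t) ↔ walk s ξ t 0 = n ∧ ∀ j < t, walk s ξ j 0 < n := by
  rw [FirstPassage, ← walk_eq]
  refine and_congr_right fun _ => ⟨fun h j hj => h _ (mem_sites_steps.2 ⟨j, hj, rfl⟩), ?_⟩
  intro h x hx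
  obtain ⟨j, hj, rfl⟩ := mem_sites_steps.1 hx
  exact h j hj

theorem separates_steps {s : Lattice d} {m : ℤ} {ξ : ℕ → Lattice d} {t : ℕ} :
    Separates s (steps ξ t) m ↔ ∃ i ≤ t, walk s ξ i 0 = m ∧ (∀ j < i, walk s ξ j 0 < m) ∧
      ∀ j, i ≤ j → j < t → m ≤ walk s ξ j 0 := by
  constructor
  · rintro ⟨l₁, l₂, e, h1, h2⟩
    have hlen : t = l₁.length + l₂.length := by
      rw [← List.length_append, ← e, steps_length]
    rw [hlen, steps_add] at e
    obtain ⟨e1, e2⟩ := List.append_inj e.symm (by simp)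
    generalize hi : l₁.length = i at e1 e2 hlen
    generalize hb : l₂.length = b at e2 hlen
    subst e1 e2 hlen
    refine ⟨i, by omega, ?_⟩
    have h1 := firstPassage_steps.1 h1
    refine ⟨h1.1, h1.2, fun j hij hjt => h2 _ (mem_sites_steps.2 ⟨j - i, by omega, ?_⟩)⟩
    rw [← walk_add]
    congr 1
    omega
  · rintro ⟨i, hit, h1, h2, h3⟩
    obtain ⟨b, rfl⟩ := Nat.exists_eq_add_of_le hit
    refine ⟨_, _, steps_add ξ i b, firstPassage_steps.2 ⟨h1, h2⟩, fun x hx => ?_⟩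
    obtain ⟨j, hj, rfl⟩ := mem_sites_steps.1 hx
    rw [← walk_add]
    exact h3 _ (by omega) (by omega)

section Path

variable {y : ℕ → Lattice d} {n t : ℕ}

theorem hit_eq (ht : y t 0 = n) (hlt : ∀ j < t, y j 0 < n) : hit n y = t :=
  firstTime_eq ht.ge fun j hj => not_le.2 (hlt j hj)

theorem exists_of_hit_lt_top (h0 : y 0 0 ≤ n) (hsf : ∀ t, y (t + 1) 0 ≤ y t 0 + 1)
    (h : hit n y < ⊤) : ∃ t : ℕ, hit n y = t ∧ y t 0 = n ∧ ∀ j < t, y j 0 < n := by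
  obtain ⟨t, ht, hp, hmin⟩ := exists_of_firstTime_lt_top h
  refine ⟨t, ht, le_antisymm ?_ hp, fun j hj => not_le.1 (hmin j hj)⟩
  cases t with
  | zero => exact h0
  | succ t =>
    have h1 := hmin t (Nat.lt_succ_self t)
    have h2 := hsf t
    omega

theorem isSeparating_iff (ht : y t 0 = n) (hlt : ∀ j < t, y j 0 < n) {k : ℕ} :
    IsSeparating n y k ↔ k ≤ n ∧ ∃ i ≤ t, y i 0 = k ∧ (∀ j < i, y j 0 < k) ∧
      ∀ j, i ≤ j → j < t → (k : ℤ) ≤ y j 0 := by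
  have hn := hit_eq ht hlt
  unfold IsSeparating
  rw [hn]
  refine and_congr_right fun hk => ?_
  constructor
  · rintro ⟨-, h1, h2, h3⟩
    have hlek : hit k y ≤ t := iInf₂_le t (by rw [ht]; exact_mod_cast hk)
    obtain ⟨i, hi, -, -⟩ := exists_of_firstTime_lt_top (hlek.trans_lt (ENat.natCast_lt_top t))
    replace hi : hit k y = i := hi
    rw [hi] at h1 h2 h3 hlek
    rw [ENat.toNat_natCast] at h2
    simp only [Nat.cast_lt, Nat.cast_le] at h1 h3 hlek
    refine ⟨i, hlek, h2, h1, fun j hij hjt => ?_⟩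
    rcases hij.eq_or_lt with rfl | hij
    · exact h2.ge
    · exact h3 j hij hjt
  · rintro ⟨i, hit', h1, h2, h3⟩
    have hi := hit_eq h1 h2
    rw [hi, ENat.toNat_natCast]
    simp only [Nat.cast_lt]
    exact ⟨ENat.natCast_lt_top t, h2, h1, fun j hij hjt => h3 j hij.le hjt⟩

theorem reaches_iff (hn : hit n y = t) (h : Lattice d → ℕ∞) :
    Reaches n y h ↔ ∀ j ≤ t, (localTime y j (y j) : ℕ∞) ≤ h (y j) := by
  unfold Reaches killTime
  rw [hn, coe_lt_firstTime]
  simp only [not_lt]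

/-- The position at time t is new, because level n was not reached before; it needs only h ≥ 1. This
is why `sites` leaves out the last position. -/
theorem localTime_le_of_card {h : Lattice d → ℕ∞} (ht : y t 0 = n) (hlt : ∀ j < t, y j 0 < n)
    (h1 : 1 ≤ h (y t))
    (hc : ∀ x, ((((Finset.range t).filter fun j => y j = x).card : ℕ) : ℕ∞) ≤ h x) :
    ∀ j ≤ t, (localTime y j (y j) : ℕ∞) ≤ h (y j) := by
  intro j hj
  rcases hj.eq_or_lt with rfl | hj
  · have : localTime y j (y j) = 1 := by
      rw [localTime, Finset.card_eq_one]
      refine ⟨j, Finset.ext fun i => ?_⟩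
      simp only [Finset.mem_filter, Finset.mem_range, Finset.mem_singleton]
      constructor
      · rintro ⟨hi, he⟩
        by_contra hne
        have h2 := hlt i (by omega)
        rw [he, ht] at h2
        exact lt_irrefl _ h2
      · rintro rfl
        exact ⟨Nat.lt_succ_self _, rfl⟩
    rw [this]
    exact_mod_cast h1
  · refine le_trans ?_ (hc (y j))
    unfold localTime
    norm_cast
    refine Finset.card_le_card (Finset.filter_subset_filter _ ?_)
    exact Finset.range_subset_range.2 hj

end Path

/-- The environment `h` allows the visits `M`. -/
def Allows (h : Lattice d → ℕ∞) (M : List (Lattice d)) : Prop :=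
  ∀ x, (M.count x : ℕ∞) ≤ h x

variable {ξ : ℕ → Lattice d} {h : Lattice d → ℕ∞}

theorem walk_succ_le (hξ : ∀ j, ξ j 0 ≤ 1) (s : Lattice d) (t : ℕ) :
    walk s ξ (t + 1) 0 ≤ walk s ξ t 0 + 1 := by
  have : walk s ξ (t + 1) = walk s ξ t + ξ t := by
    rw [walk, walk, Finset.sum_range_succ, add_assoc]
  rw [this, Pi.add_apply]
  linarith [hξ t]

theorem isSeparating_walk_iff {s : Lattice d} {n t : ℕ} (hf : FirstPassage s n (steps ξ t))
    {k : ℕ} : IsSeparating n (walk s ξ) k ↔ k ≤ n ∧ Separates s (steps ξ t) k := by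
  obtain ⟨h1, h2⟩ := firstPassage_steps.1 hf
  rw [isSeparating_iff h1 h2, separates_steps]

theorem reaches_walk_iff {s : Lattice d} {n t : ℕ} (hf : FirstPassage s n (steps ξ t))
    (h1 : 1 ≤ h (walk s ξ t)) :
    Reaches n (walk s ξ) h ↔ Allows h (sites s (steps ξ t)) := by
  obtain ⟨h2, h3⟩ := firstPassage_steps.1 hf
  rw [reaches_iff (hit_eq h2 h3)]
  simp only [Allows, count_sites_steps]
  exact ⟨card_visits_le, localTime_le_of_card h2 h3 h1⟩

theorem exists_firstPassage_of_reaches (hξ : ∀ j, ξ j 0 ≤ 1) {s : Lattice d} {n : ℕ}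
    (hs : s 0 ≤ n) (hr : Reaches n (walk s ξ) h) :
    ∃ t, FirstPassage s n (steps ξ t) ∧ Allows h (sites s (steps ξ t)) := by
  obtain ⟨t, h1, h2, h3⟩ := exists_of_hit_lt_top (y := walk s ξ) (by simpa [walk] using hs)
    (walk_succ_le hξ s) (hr.trans_le le_top)
  refine ⟨t, firstPassage_steps.2 ⟨h2, h3⟩, ?_⟩
  rw [reaches_iff h1] at hr
  simp only [Allows, count_sites_steps]
  exact card_visits_le hr

theorem etaStar_eq_of_reaches {n : ℕ} {y : ℕ → Lattice d} (hr : Reaches n y h) :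
    etaStar n y h = eta n y := if_pos hr

theorem reaches_of_etaStar {n : ℕ} {y : ℕ → Lattice d} (hr : etaStar n y h ≠ -1) :
    Reaches n y h := by
  by_contra hn
  exact hr (if_neg hn)

/-- Level n always separates, so when there is a single separating level it is n. -/
theorem exists_unseparated_of_etaStar (hξ : ∀ j, ξ j 0 ≤ 1) {s : Lattice d} {n : ℕ}
    (hs : s 0 ≤ 0) (he : etaStar n (walk s ξ) h = 0) :
    ∃ t, Unseparated Set.univ s n (steps ξ t) ∧ Allows h (sites s (steps ξ t)) := by
  classical
  have hr : Reaches n (walk s ξ) h := reaches_of_etaStar (by rw [he]; norm_num)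
  obtain ⟨t, hf, ha⟩ := exists_firstPassage_of_reaches hξ (hs.trans (by positivity)) hr
  refine ⟨t, ⟨hf, fun j _ hj hsep => ?_⟩, ha⟩
  rw [etaStar_eq_of_reaches hr, eta] at he
  have hcard : ((Finset.range (n + 1)).filter (IsSeparating n (walk s ξ))).card ≤ 1 := by
    have : (((Finset.range (n + 1)).filter (IsSeparating n (walk s ξ))).card : ℤ) = 1 := by
      convert sub_eq_zero.1 he
    omega
  have hn : IsSeparating n (walk s ξ) n := (isSeparating_walk_iff hf).2 ⟨le_rfl, hf.separates⟩
  have hjs : IsSeparating n (walk s ξ) j := (isSeparating_walk_iff hf).2 ⟨hj.le, hsep⟩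
  exact hj.ne (Finset.card_le_one.1 hcard j
    (Finset.mem_filter.2 ⟨Finset.mem_range.2 (by omega), hjs⟩) n
    (Finset.mem_filter.2 ⟨Finset.mem_range.2 (by omega), hn⟩))

theorem etaStar_zero_of_reaches (hξ : ∀ j, ξ j 0 ≤ 1) {s : Lattice d} (hs : s 0 ≤ 0)
    (hr : Reaches 0 (walk s ξ) h) : etaStar 0 (walk s ξ) h = 0 := by
  classical
  obtain ⟨t, hf, -⟩ := exists_firstPassage_of_reaches (n := 0) hξ hs hr
  have hn : IsSeparating 0 (walk s ξ) 0 := (isSeparating_walk_iff hf).2 ⟨le_rfl, hf.separates⟩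
  rw [etaStar_eq_of_reaches hr, eta, zero_add, Finset.range_one, Finset.filter_singleton,
    if_pos hn]
  simp

/-- The vanishing constraints below level 0 kill any path that goes there, so survival forces an
upward path. For such a path both 0 and n separate, and 0 is the largest below n exactly when
nothing lies between. -/
theorem kappaStar_eq_zero_iff (hξ : ∀ j, ξ j 0 ≤ 1) (h1 : ∀ x : Lattice d, 0 ≤ x 0 → 1 ≤ h x)
    {n : ℕ} (hn : 0 < n) :
    kappaStar n (walk 0 ξ) (zeroBelow h) = (0 : ℕ) ↔
      ∃ t, (Upward n (steps ξ t) ∧ ∀ j, 0 < j → j < n → ¬ Separates 0 (steps ξ t) j) ∧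
        Allows h ((sites 0 (steps ξ t)).filter fun x => 0 ≤ x 0) := by
  classical
  have hsep0 : ∀ {t}, Upward n (steps ξ t) → Separates 0 (steps ξ t) ((0 : ℕ) : ℤ) := by
    intro t hu
    exact ⟨[], steps ξ t, rfl, ⟨by simp, by simp⟩, fun x hx => by
      simpa using hu.2 x (by simpa only [List.sum_nil, add_zero] using hx)⟩
  constructor
  · intro hk
    have heta : 1 ≤ etaStar n (walk 0 ξ) (zeroBelow h) := by
      by_contra hlt
      rw [kappaStar, if_neg hlt] at hk
      exact WithBot.bot_ne_coe hk
    rw [kappaStar, if_pos heta] at hk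
    have hr := reaches_of_etaStar (fun he => by rw [he] at heta; norm_num at heta)
    obtain ⟨t, hf, ha⟩ := exists_firstPassage_of_reaches (s := 0) hξ (by simp) hr
    have hpos : ∀ x ∈ sites 0 (steps ξ t), 0 ≤ x 0 := by
      intro x hx
      by_contra hneg
      have h2 := ha x
      rw [zeroBelow, if_neg hneg] at h2
      have h3 := List.count_pos_iff.2 hx
      have h4 : (sites 0 (steps ξ t)).count x = 0 := by exact_mod_cast le_antisymm h2 bot_le
      omega
    refine ⟨t, ⟨⟨hf, hpos⟩, fun j hj0 hjn hs => ?_⟩, fun x => ?_⟩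
    · have hjs : IsSeparating n (walk 0 ξ) j := (isSeparating_walk_iff hf).2 ⟨hjn.le, hs⟩
      unfold kappa at hk
      have := Finset.le_max_of_eq (Finset.mem_filter.2 ⟨Finset.mem_range.2 hjn, hjs⟩) hk
      omega
    · rw [List.filter_eq_self.2 (by simpa using hpos)]
      refine (ha x).trans ?_
      unfold zeroBelow
      split_ifs
      · exact le_rfl
      · exact bot_le
  · rintro ⟨t, ⟨hu, hns⟩, ha⟩
    rw [List.filter_eq_self.2 (by simpa using hu.2)] at ha
    have hw := (firstPassage_steps.1 hu.1).1
    have hr : Reaches n (walk 0 ξ) (zeroBelow h) := by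
      have hz : 0 ≤ walk 0 ξ t 0 := by rw [hw]; positivity
      refine (reaches_walk_iff hu.1 (by rw [zeroBelow, if_pos hz]; exact h1 _ hz)).2 fun x => ?_
      unfold zeroBelow
      split_ifs with hx
      · exact ha x
      · rw [List.count_eq_zero_of_not_mem fun hmem => hx (hu.2 x hmem)]
        simp
    have hs0 : IsSeparating n (walk 0 ξ) 0 :=
      (isSeparating_walk_iff hu.1).2 ⟨Nat.zero_le _, hsep0 hu⟩
    have hsn : IsSeparating n (walk 0 ξ) n :=
      (isSeparating_walk_iff hu.1).2 ⟨le_rfl, hu.1.separates⟩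
    have heta : 1 ≤ etaStar n (walk 0 ξ) (zeroBelow h) := by
      rw [etaStar_eq_of_reaches hr, eta]
      have hsub : ({0, n} : Finset ℕ) ⊆
          (Finset.range (n + 1)).filter (IsSeparating n (walk 0 ξ)) := by
        intro j hj
        rw [Finset.mem_insert, Finset.mem_singleton] at hj
        rcases hj with rfl | rfl
        · exact Finset.mem_filter.2 ⟨by simp, hs0⟩
        · exact Finset.mem_filter.2 ⟨by simp, hsn⟩
      have hc := Finset.card_le_card hsub
      rw [Finset.card_pair hn.ne] at hc
      have : (2 : ℤ) ≤ ((Finset.range (n + 1)).filter (IsSeparating n (walk 0 ξ))).card := by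
        exact_mod_cast hc
      linarith
    rw [kappaStar, if_pos heta, kappa]
    have hset : (Finset.range n).filter (IsSeparating n (walk 0 ξ)) = {0} := by
      ext j
      rw [Finset.mem_filter, Finset.mem_range, Finset.mem_singleton]
      constructor
      · rintro ⟨hj, hs⟩
        by_contra hj0
        exact hns j (Nat.pos_of_ne_zero hj0) hj ((isSeparating_walk_iff hu.1).1 hs).2
      · rintro rfl
        exact ⟨hn, hs0⟩
    rw [hset]
    rfl

end LocalConstraints

end

/-! ### Probabilities of path events -/

noncomputable section

namespace LocalConstraints

variable {d : ℕ} {Ω : Type*} {ξ : ℕ → Ω → Lattice d}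
  {H : Lattice d → Ω → ℕ∞} {S₀ : Ω → Lattice d}

/-- The event that the walk starts with the steps `l`. -/
def startsWith (ξ : ℕ → Ω → Lattice d) (l : List (Lattice d)) : Set Ω :=
  {ω | steps (fun j => ξ j ω) l.length = l}

/-- The event that the constraints allow the visits `M`. -/
def allowed (H : Lattice d → Ω → ℕ∞) (M : List (Lattice d)) : Set Ω :=
  {ω | Allows (fun x => H x ω) M}

theorem startsWith_eq (l : List (Lattice d)) :
    startsWith ξ l = ⋂ i ∈ Finset.range l.length, ξ i ⁻¹' {l.getD i 0} := by
  ext ω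
  simp only [startsWith, Set.mem_ofPred_eq, Set.mem_iInter, Finset.mem_range, Set.mem_preimage,
    Set.mem_singleton_iff]
  constructor
  · intro h i hi
    have := congrArg (fun l' => l'.getD i 0) h
    simpa [steps, hi] using this
  · intro h
    refine List.ext_getElem (by simp) fun i h1 h2 => ?_
    have := h i h2
    simpa [steps, h2] using this

theorem allowed_eq (M : List (Lattice d)) :
    allowed H M = ⋂ x ∈ M.toFinset, H x ⁻¹' Set.Ici (M.count x : ℕ∞) := by
  ext ω
  simp only [allowed, Allows, Set.mem_ofPred_eq, Set.mem_iInter, Set.mem_preimage, Set.mem_Ici,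
    List.mem_toFinset]
  refine ⟨fun h x _ => h x, fun h x => ?_⟩
  by_cases hx : x ∈ M
  · exact h x hx
  · simp [List.count_eq_zero_of_not_mem hx]

theorem prod_getD (p : Lattice d → ℝ≥0∞) (l : List (Lattice d)) :
    ∏ i ∈ Finset.range l.length, p (l.getD i 0) = pathProb p l := by
  induction l with
  | nil => simp
  | cons a l ih =>
    rw [List.length_cons, Finset.prod_range_succ', pathProb_cons, ← ih, mul_comm]
    simp

/-- The union of the events `{l is a prefix of the walk} ∩ C l` over a family of paths. -/
theorem setOf_exists_steps (F : List (Lattice d) → Prop) (C : List (Lattice d) → Set Ω) :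
    {ω | ∃ t, F (steps (fun j => ξ j ω) t) ∧ ω ∈ C (steps (fun j => ξ j ω) t)} =
      ⋃ l : {l // F l}, startsWith ξ l ∩ C l := by
  ext ω
  simp only [Set.mem_ofPred_eq, Set.mem_iUnion, Subtype.exists, Set.mem_inter_iff]
  constructor
  · rintro ⟨t, h1, h2⟩
    exact ⟨_, h1, by simp [startsWith], h2⟩
  · rintro ⟨l, h1, h2, h3⟩
    have h2 : steps (fun j => ξ j ω) l.length = l := h2
    exact ⟨l.length, h2.symm ▸ h1, h2.symm ▸ h3⟩

theorem startsWith_prefix {l l' : List (Lattice d)} {ω : Ω} (h : ω ∈ startsWith ξ l)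
    (h' : ω ∈ startsWith ξ l') (hle : l.length ≤ l'.length) : l <+: l' := by
  obtain ⟨b, hb⟩ := Nat.exists_eq_add_of_le hle
  have h : steps (fun j => ξ j ω) l.length = l := h
  have h' : steps (fun j => ξ j ω) l'.length = l' := h'
  rw [hb, steps_add, h] at h'
  exact ⟨_, h'⟩

variable [MeasurableSpace Ω] {P : Measure Ω}

/-- The distribution of a step. -/
def stepLaw (P : Measure Ω) (ξ : ℕ → Ω → Lattice d) (a : Lattice d) : ℝ≥0∞ := P {ω | ξ 0 ω = a}

/-- The tail function of the constraint at the origin. -/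
def tail (P : Measure Ω) (H : Lattice d → Ω → ℕ∞) (k : ℕ) : ℝ≥0∞ := P {ω | (k : ℕ∞) ≤ H 0 ω}

theorem tail_zero [IsProbabilityMeasure P] : tail P H 0 = 1 := by simp [tail]

theorem tail_antitone : Antitone (tail P H) := by
  intro a b hab
  refine measure_mono fun ω (hω : (b : ℕ∞) ≤ H 0 ω) => ?_
  exact (Nat.cast_le.2 hab).trans hω

/-- A walk has at most one initial segment in a prefix-free family, so the union over the family is
disjoint. -/
theorem measure_exists_steps {F : List (Lattice d) → Prop} [DecidablePred F] {C : List (Lattice d) → Set Ω}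
    (hF : ∀ l l', F l → F l' → l <+: l' → l = l') (hξ : ∀ l, MeasurableSet (startsWith ξ l))
    (hC : ∀ l, MeasurableSet (C l)) :
    P {ω | ∃ t, F (steps (fun j => ξ j ω) t) ∧ ω ∈ C (steps (fun j => ξ j ω) t)} =
      ∑' l, if F l then P (startsWith ξ l ∩ C l) else 0 := by
  rw [setOf_exists_steps, measure_iUnion]
  · exact (tsum_subtype {l | F l} fun l => P (startsWith ξ l ∩ C l)).trans
      (tsum_congr fun l => by simp [Set.indicator_apply])
  · rintro ⟨l, hl⟩ ⟨l', hl'⟩ hne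
    refine Set.disjoint_left.2 fun ω hω hω' => hne (Subtype.ext ?_)
    rcases le_total l.length l'.length with hle | hle
    · exact hF l l' hl hl' (startsWith_prefix hω.1 hω'.1 hle)
    · exact (hF l' l hl' hl (startsWith_prefix hω'.1 hω.1 hle)).symm
  · exact fun l => (hξ l).inter (hC l)

theorem measure_exists_steps_le (F : List (Lattice d) → Prop) [DecidablePred F] (C : List (Lattice d) → Set Ω) :
    P {ω | ∃ t, F (steps (fun j => ξ j ω) t) ∧ ω ∈ C (steps (fun j => ξ j ω) t)} ≤
      ∑' l, if F l then P (startsWith ξ l ∩ C l) else 0 := by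
  rw [setOf_exists_steps]
  refine (measure_iUnion_le _).trans_eq ?_
  exact (tsum_subtype {l | F l} fun l => P (startsWith ξ l ∩ C l)).trans
    (tsum_congr fun l => by simp [Set.indicator_apply])

theorem exists_tail_lt_one [IsProbabilityMeasure P] (hH : Measurable (H 0))
    (h : 0 < P {ω | H 0 ω < ⊤}) : ∃ k, tail P H (k + 1) < 1 := by
  by_contra! hn
  refine h.ne' (measure_mono_null (t := ⋃ k : ℕ, {ω | ((k + 1 : ℕ) : ℕ∞) ≤ H 0 ω}ᶜ) ?_ ?_)
  · intro ω (hω : H 0 ω < ⊤)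
    obtain ⟨k, hk⟩ := ENat.ne_top_iff_exists.1 hω.ne
    refine Set.mem_iUnion.2 ⟨k, ?_⟩
    rw [Set.mem_compl_iff, Set.mem_ofPred_eq, ← hk, not_le, Nat.cast_lt]
    exact Nat.lt_succ_self k
  · rw [measure_iUnion_null_iff]
    intro k
    have hm : MeasurableSet {ω | ((k + 1 : ℕ) : ℕ∞) ≤ H 0 ω} :=
      hH (Set.to_countable (Set.Ici ((k + 1 : ℕ) : ℕ∞))).measurableSet
    rw [prob_compl_eq_zero_iff hm]
    exact le_antisymm prob_le_one (hn k)

theorem tsum_tail_ne_top [IsProbabilityMeasure P] (hH : Measurable (H 0))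
    (h : ∫⁻ ω, (H 0 ω : ℝ≥0∞) ∂P < ⊤) : ∑' k, tail P H k ≠ ⊤ := by
  classical
  have hm : ∀ k : ℕ, MeasurableSet {ω | (k : ℕ∞) ≤ H 0 ω} := fun k =>
    hH (Set.to_countable (Set.Ici (k : ℕ∞))).measurableSet
  have e : ∑' k, tail P H k =
      ∫⁻ ω, ∑' k : ℕ, ({ω | (k : ℕ∞) ≤ H 0 ω}.indicator 1 ω : ℝ≥0∞) ∂P := by
    rw [lintegral_tsum fun k => (measurable_one.indicator (hm k)).aemeasurable]
    exact tsum_congr fun k => (lintegral_indicator_one (hm k)).symm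
  have hle : ∀ N : ℕ∞, ∑' k : ℕ, (if (k : ℕ∞) ≤ N then 1 else 0 : ℝ≥0∞) ≤ (N : ℝ≥0∞) + 1 := by
    intro N
    induction N using ENat.recTopCoe with
    | top => simp
    | coe N =>
      rw [tsum_eq_sum (s := Finset.range (N + 1))]
      · refine (Finset.sum_le_card_nsmul _ _ 1 fun k _ => ?_).trans (by simp)
        split_ifs <;> simp
      · intro k hk
        rw [if_neg]
        rw [Nat.cast_le]
        simpa using hk
  rw [e]
  refine ne_top_of_le_ne_top (b := ∫⁻ ω, ((H 0 ω : ℝ≥0∞) + 1) ∂P) ?_ (lintegral_mono fun ω => ?_)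
  · rw [lintegral_add_right _ measurable_const]
    simpa using h.ne
  · refine le_trans (ENNReal.tsum_le_tsum fun k => ?_) (hle (H 0 ω))
    simp [Set.indicator_apply]

variable [NeZero d]

theorem A1.measurableSet_startsWith (h1 : A1 P ξ) (l : List (Lattice d)) :
    MeasurableSet (startsWith ξ l) := by
  rw [startsWith_eq]
  exact Finset.measurableSet_biInter _ fun i _ => h1.measurable i (.singleton _)

theorem A1.measure_startsWith (h1 : A1 P ξ) (l : List (Lattice d)) :
    P (startsWith ξ l) = pathProb (stepLaw P ξ) l := by
  rw [startsWith_eq, h1.indep.measure_inter_preimage_eq_mul _ fun i _ => .singleton _,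
    ← prod_getD]
  exact Finset.prod_congr rfl fun i _ => (h1.ident i).measure_mem_eq (.singleton _)

theorem A1.ae_skipFree (h1 : A1 P ξ) : ∀ᵐ ω ∂P, ∀ j, ξ j ω 0 ≤ 1 := by
  rw [ae_all_iff]
  intro j
  exact (h1.ident j).symm.ae_snd (p := fun a : Lattice d => a 0 ≤ 1)
    (Set.to_countable _).measurableSet h1.skipFree

theorem A1.stepLaw_skipFree (h1 : A1 P ξ) (a : Lattice d) (ha : stepLaw P ξ a ≠ 0) : a 0 ≤ 1 := by
  by_contra hlt
  refine ha (measure_mono_null (fun ω hω => ?_) (ae_iff.1 h1.skipFree))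
  have hω : ξ 0 ω = a := hω
  simpa only [Set.mem_ofPred_eq, hω] using hlt

theorem A1.exists_step_up (h1 : A1 P ξ) : ∃ a : Lattice d, a 0 = 1 ∧ stepLaw P ξ a ≠ 0 := by
  by_contra! hn
  refine h1.up.ne' (measure_mono_null (t := ⋃ a : {a : Lattice d // a 0 = 1}, {ω | ξ 0 ω = a})
    (fun ω hω => Set.mem_iUnion.2 ⟨⟨ξ 0 ω, hω⟩, rfl⟩) ?_)
  rw [measure_iUnion_null_iff]
  exact fun a => hn a a.2

theorem A3.tail_one [IsProbabilityMeasure P] (h3 : A3 P H) : tail P H 1 = 1 := by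
  have : ∀ᵐ ω ∂P, ((1 : ℕ) : ℕ∞) ≤ H 0 ω := by simpa using h3.one_le
  have h : {ω | ((1 : ℕ) : ℕ∞) ≤ H 0 ω} =ᵐ[P] Set.univ := Filter.eventuallyEq_univ.2 this
  rw [tail, measure_congr h, measure_univ]

/-- The families of (A2) without the environment below level `0`. -/
theorem A2.measure_inter (h2 : A2 P S₀ ξ H) {A : Set Ω} (hA : MeasurableSet[.comap S₀ ⊤] A)
    (l : List (Lattice d)) {M : List (Lattice d)} (hM : ∀ x ∈ M, 0 ≤ x 0) :
    P (A ∩ (startsWith ξ l ∩ allowed H M)) =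
      P A * (P (startsWith ξ l) * P (allowed H M)) := by
  have h := h2.indep.meas_iInter (s := ![A, startsWith ξ l, allowed H M]) fun i => by
    fin_cases i
    · have : (MeasurableSpace.comap S₀ inferInstance : MeasurableSpace Ω) = .comap S₀ ⊤ := by
        congr 1
        exact (MeasurableSpace.ext fun s => ⟨fun _ => trivial, fun _ => s.to_countable.measurableSet⟩)
      refine MeasurableSpace.le_def.1 le_sup_left A ?_
      rw [this]
      exact hA
    · change MeasurableSet[⨆ j : ℕ, MeasurableSpace.comap (ξ j) inferInstance] (startsWith ξ l)
      rw [startsWith_eq]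
      refine Finset.measurableSet_biInter _ fun i _ => ?_
      exact MeasurableSpace.le_def.1 (le_iSup (fun j => MeasurableSpace.comap (ξ j) inferInstance) i)
        _ ⟨_, .singleton _, rfl⟩
    · change MeasurableSet[⨆ x : {x : Lattice d // 0 ≤ x 0},
        MeasurableSpace.comap (H x) inferInstance] (allowed H M)
      rw [allowed_eq]
      refine Finset.measurableSet_biInter _ fun x hx => ?_
      exact MeasurableSpace.le_def.1 (le_iSup (fun x : {x : Lattice d // 0 ≤ x 0} =>
        MeasurableSpace.comap (H x) inferInstance) ⟨x, hM x (List.mem_toFinset.1 hx)⟩)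
        _ ⟨_, (Set.to_countable _).measurableSet, rfl⟩
  rw [Fin.prod_univ_three] at h
  have e : A ∩ (startsWith ξ l ∩ allowed H M) =
      ⋂ i, (![A, startsWith ξ l, allowed H M] : Fin 3 → Set Ω) i := by
    ext ω
    simp [Set.mem_iInter, Fin.forall_fin_succ]
  rw [e, h, mul_assoc]
  rfl

theorem A2.measurableSet_allowed (h2 : A2 P S₀ ξ H) (M : List (Lattice d)) :
    MeasurableSet (allowed H M) := by
  rw [allowed_eq]
  exact Finset.measurableSet_biInter _ fun x _ =>
    h2.measurable_env x (Set.to_countable _).measurableSet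

theorem A3.measure_allowed (h3 : A3 P H) {M : List (Lattice d)} (hM : ∀ x ∈ M, 0 ≤ x 0) :
    P (allowed H M) = allow (tail P H) M := by
  have hsub : ∀ x ∈ M.toFinset, 0 ≤ x 0 := fun x hx => hM x (List.mem_toFinset.1 hx)
  have e : allowed H M = ⋂ x ∈ M.toFinset.subtype (fun x : Lattice d => 0 ≤ x 0),
      H x ⁻¹' Set.Ici (M.count (x : Lattice d) : ℕ∞) := by
    rw [allowed_eq]
    ext ω
    simp only [Set.mem_iInter, Finset.mem_subtype, Subtype.forall]
    exact ⟨fun h x _ hx => h x hx, fun h x hx => h x (hsub x hx) hx⟩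
  rw [e, h3.indep.measure_inter_preimage_eq_mul _ fun x _ => (Set.to_countable _).measurableSet,
    Finset.prod_subtype_of_mem (fun x => P (H x ⁻¹' Set.Ici (M.count x : ℕ∞))) hsub, allow]
  exact Finset.prod_congr rfl fun x hx =>
    (h3.ident x (hsub x hx)).measure_mem_eq (Set.to_countable _).measurableSet

end LocalConstraints

end

/-! ### Excursions and return times -/

noncomputable section

namespace LocalConstraints

variable {d : ℕ} [NeZero d] {Ω : Type*} {ξ : ℕ → Ω → Lattice d} {H : Lattice d → Ω → ℕ∞}
  {S₀ : Ω → Lattice d}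

/-- The path from `0` makes its first return to level `0` with its last step. -/
def IsExcursion (l : List (Lattice d)) : Prop :=
  l ≠ [] ∧ l.sum 0 = 0 ∧ ∀ x ∈ (sites 0 l).tail, x 0 ≠ 0

theorem IsExcursion.prefix_eq {l l' : List (Lattice d)} (h : IsExcursion l)
    (h' : IsExcursion l') (hl : l <+: l') : l = l' := by
  obtain ⟨c, rfl⟩ := hl
  by_contra hne
  have hc : c ≠ [] := by rintro rfl; simp at hne
  obtain ⟨h1, h2, -⟩ := h
  cases l with
  | nil => exact h1 rfl
  | cons a l =>
    refine h'.2.2 (a + l.sum) ?_ (by simpa using h2)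
    simpa using mem_sites_prefix (s := a) (l := l) hc

theorem FirstVisit.prefix_eq {s : Lattice d} {l l' : List (Lattice d)} (h : FirstVisit s l)
    (h' : FirstVisit s l') (hl : l <+: l') : l = l' := by
  obtain ⟨c, rfl⟩ := hl
  by_contra hne
  have hc : c ≠ [] := by rintro rfl; simp at hne
  exact h'.2 _ (mem_sites_prefix hc) h.1

theorem IsExcursion.walk {ξ : ℕ → Lattice d} {t : ℕ} (h : IsExcursion (steps ξ t)) :
    0 < t ∧ walk 0 ξ t 0 = 0 ∧ ∀ j < t, ¬ (0 < j ∧ walk 0 ξ j 0 = 0) := by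
  obtain ⟨h1, h2, h3⟩ := h
  have ht : 0 < t := by
    have := List.length_pos_iff.2 h1
    rwa [steps_length] at this
  refine ⟨ht, by simpa [walk_eq] using h2, fun j hj ⟨hj0, hw⟩ => h3 _ ?_ hw⟩
  obtain ⟨t, rfl⟩ := Nat.exists_eq_succ_of_ne_zero ht.ne'
  obtain ⟨j, rfl⟩ := Nat.exists_eq_succ_of_ne_zero hj0.ne'
  rw [sites_steps, Nat.succ_eq_add_one, List.range_succ_eq_map, List.map_cons, List.tail_cons]
  simp only [List.map_map, List.mem_map, List.mem_range]
  exact ⟨j, by omega, rfl⟩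

theorem tsum_excursion (p : Lattice d → ℝ≥0∞) : ∑' y, excursion p y =
    ∑' l : List (Lattice d), open Classical in if IsExcursion l then pathProb p l else 0 := by
  classical
  have h := tsum_excursion_mul (p := p) fun _ => 1
  simp only [mul_one] at h
  rw [h]
  exact tsum_congr fun l => if_congr Iff.rfl rfl rfl

theorem excursion_zero (p : Lattice d → ℝ≥0∞) : excursion p 0 =
    ∑' l : List (Lattice d),
      open Classical in if IsExcursion l ∧ l.sum = 0 then pathProb p l else 0 := by
  classical
  refine tsum_congr fun l => if_congr ?_ rfl rfl
  constructor
  · rintro ⟨h1, h2, -, h3⟩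
    exact ⟨⟨h1, by rw [h2]; rfl, h3⟩, h2⟩
  · rintro ⟨⟨h1, -, h3⟩, h2⟩
    exact ⟨h1, h2, rfl, h3⟩

/-- A possible path that ends on level `0` gives a possible path of the induced walk. -/
theorem exists_induced_path {p : Lattice d → ℝ≥0∞} (n : ℕ) (l : List (Lattice d))
    (hn : l.length ≤ n) (hp : pathProb p l ≠ 0) (h0 : l.sum 0 = 0) :
    ∃ O : List (Lattice d), (l ≠ [] → O ≠ []) ∧ O.sum = l.sum ∧ pathProb (excursion p) O ≠ 0 := by
  classical
  induction n generalizing l with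
  | zero =>
    have : l = [] := List.length_eq_zero_iff.1 (by omega)
    subst this
    exact ⟨[], by simp, rfl, by simp⟩
  | succ n ih =>
    cases l with
    | nil => exact ⟨[], by simp, rfl, by simp⟩
    | cons a l =>
      obtain ⟨l₁, l₂, rfl, h1, h2⟩ := exists_first_visit (s := a) (l := l) (by simpa using h0)
      rw [← List.cons_append, pathProb_append] at hp
      obtain ⟨O, -, hO, hpO⟩ := ih l₂ (by simp at hn; omega) (right_ne_zero_of_mul hp) (by
        simp only [List.sum_cons, List.sum_append, Pi.add_apply] at h0 h1
        omega)
      refine ⟨(a :: l₁).sum :: O, by simp, by simp [hO, add_assoc], ?_⟩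
      rw [pathProb_cons]
      refine mul_ne_zero (fun he => left_ne_zero_of_mul hp ?_) hpO
      have := ENNReal.tsum_eq_zero.1 he (a :: l₁)
      rwa [if_pos ⟨by simp, rfl, by simpa using h1, by simpa using h2⟩] at this

variable [MeasurableSpace Ω] {P : Measure Ω}

section Steps

/-- The probability that the walk takes one of the paths of a prefix-free family. -/
theorem A1.measure_exists (h1 : A1 P ξ) {F : List (Lattice d) → Prop} [DecidablePred F]
    (hF : ∀ l l', F l → F l' → l <+: l' → l = l') :
    ∑' l, (if F l then pathProb (stepLaw P ξ) l else 0) =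
      P {ω | ∃ t, F (steps (fun j => ξ j ω) t)} := by
  have := measure_exists_steps (P := P) (C := fun _ => Set.univ) hF h1.measurableSet_startsWith
    fun _ => .univ
  simp only [Set.mem_univ, and_true, Set.inter_univ, h1.measure_startsWith] at this
  exact this.symm

/-- There are countably many loops, so one has positive probability; cutting it at its visits to
level 0 gives a loop of the induced walk. -/
theorem A1.exists_loop (h1 : A1 P ξ) (h : 0 < P {ω | returnOrigin (fun j => ξ j ω) < ⊤}) :
    ∃ O : List (Lattice d), O ≠ [] ∧ O.sum = 0 ∧ pathProb (excursion (stepLaw P ξ)) O ≠ 0 := by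
  obtain ⟨l, hl, hs, hp⟩ : ∃ l : List (Lattice d), l ≠ [] ∧ l.sum = 0 ∧
      pathProb (stepLaw P ξ) l ≠ 0 := by
    by_contra! hn
    refine h.ne' (measure_mono_null
      (t := ⋃ l : {l : List (Lattice d) // l ≠ [] ∧ l.sum = 0}, startsWith ξ l) ?_ ?_)
    · intro ω hω
      obtain ⟨t, -, ⟨h2, h3⟩, -⟩ := exists_of_firstTime_lt_top hω
      refine Set.mem_iUnion.2 ⟨⟨steps (fun j => ξ j ω) t, ?_, ?_⟩, by simp [startsWith]⟩
      · rw [← List.length_pos_iff, steps_length]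
        exact h2
      · rwa [walk_eq, zero_add] at h3
    · rw [measure_iUnion_null_iff]
      intro l
      rw [h1.measure_startsWith]
      exact hn l l.2.1 l.2.2
  obtain ⟨O, h2, h3, h4⟩ := exists_induced_path l.length l le_rfl hp (by rw [hs]; rfl)
  exact ⟨O, h2 hl, h3.trans hs, h4⟩

variable [IsProbabilityMeasure P]

theorem A1.tsum_le_one (h1 : A1 P ξ) {F : List (Lattice d) → Prop} [DecidablePred F]
    (hF : ∀ l l', F l → F l' → l <+: l' → l = l') :
    ∑' l, (if F l then pathProb (stepLaw P ξ) l else 0) ≤ 1 :=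
  (h1.measure_exists hF).trans_le prob_le_one

theorem A1.tsum_excursion_le_one (h1 : A1 P ξ) : ∑' y, excursion (stepLaw P ξ) y ≤ 1 := by
  classical
  rw [tsum_excursion]
  exact h1.tsum_le_one fun l l' h h' => h.prefix_eq h'

/-- The mass of the excursion law is the probability of completing an excursion, which is a return
to level 0. -/
theorem A1.returnLevel_of_tsum (h1 : A1 P ξ) (h : ∑' y, excursion (stepLaw P ξ) y = 1) :
    P {ω | returnLevel (fun j => ξ j ω) < ⊤} = 1 := by
  classical
  rw [tsum_excursion, h1.measure_exists fun l l' h h' => h.prefix_eq h'] at h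
  refine le_antisymm prob_le_one (h.ge.trans (measure_mono fun ω hω => ?_))
  obtain ⟨t, ht⟩ := hω
  have h2 := ht.walk
  have : returnLevel (fun j => ξ j ω) = t := firstTime_eq ⟨h2.1, h2.2.1⟩ h2.2.2
  rw [Set.mem_ofPred_eq, this]
  exact ENat.natCast_lt_top t

theorem A1.returnOrigin_of_excursion_zero (h1 : A1 P ξ) (h : excursion (stepLaw P ξ) 0 = 1) :
    P {ω | returnLevel (fun j => ξ j ω) = returnOrigin (fun j => ξ j ω) ∧
      returnOrigin (fun j => ξ j ω) < ⊤} = 1 := by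
  classical
  rw [excursion_zero, h1.measure_exists fun l l' h h' => h.1.prefix_eq h'.1] at h
  refine le_antisymm prob_le_one (h.ge.trans (measure_mono fun ω hω => ?_))
  obtain ⟨t, ht, hs⟩ := hω
  have h2 := ht.walk
  have e1 : returnLevel (fun j => ξ j ω) = t := firstTime_eq ⟨h2.1, h2.2.1⟩ h2.2.2
  have e2 : returnOrigin (fun j => ξ j ω) = t :=
    firstTime_eq ⟨h2.1, by rw [walk_eq, hs, add_zero]⟩ fun j hj hw =>
      h2.2.2 j hj ⟨hw.1, by rw [hw.2]; rfl⟩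
  exact ⟨e1.trans e2.symm, e2 ▸ ENat.natCast_lt_top t⟩

end Steps

end LocalConstraints

end

/-! ### Assembly: the model and the three series -/

noncomputable section

namespace LocalConstraints

variable {d : ℕ} [NeZero d] {Ω : Type*} [MeasurableSpace Ω] {P : Measure Ω}
  {ξ : ℕ → Ω → Lattice d} {H : Lattice d → Ω → ℕ∞} {S₀ : Ω → Lattice d}

theorem ae_one_le (h3 : A3 P H) : ∀ᵐ ω ∂P, ∀ x : Lattice d, 0 ≤ x 0 → 1 ≤ H x ω := by
  rw [ae_all_iff]
  intro x
  by_cases hx : 0 ≤ x 0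
  · filter_upwards [(h3.ident x hx).symm.ae_snd (p := fun k : ℕ∞ => 1 ≤ k)
      (Set.to_countable _).measurableSet h3.one_le] with ω hω _ using hω
  · exact Filter.Eventually.of_forall fun ω h => absurd h hx

theorem measure_start_cost (h1 : A1 P ξ) (h2 : A2 P S₀ ξ H) (h3 : A3 P H) {A : Set Ω}
    (hA : MeasurableSet[.comap S₀ ⊤] A) (s : Lattice d) (l : List (Lattice d)) :
    P (A ∩ (startsWith ξ l ∩ allowed H ((sites s l).filter fun x => 0 ≤ x 0))) =
      P A * cost (stepLaw P ξ) (tail P H) s l := by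
  have hM : ∀ x ∈ (sites s l).filter fun x => 0 ≤ x 0, 0 ≤ x 0 :=
    fun x hx => by simpa using List.of_mem_filter hx
  rw [h2.measure_inter hA l hM, h1.measure_startsWith, h3.measure_allowed hM, cost]

/-- Sum over starting points and paths. The constraints below level 0, about which little is
assumed, are dropped, which costs equality. -/
theorem measure_etaStar_le (h1 : A1 P ξ) (h2 : A2 P S₀ ξ H) (h3 : A3 P H) (n : ℕ) :
    P {ω | etaStar n (walk (S₀ ω) fun j => ξ j ω) (fun x => H x ω) = 0} ≤
      ∑' s, P {ω | S₀ ω = s} *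
        total (stepLaw P ξ) (tail P H) s (Unseparated Set.univ s n) := by
  classical
  calc _ ≤ P (⋃ s, {ω | ∃ t, Unseparated Set.univ s n (steps (fun j => ξ j ω) t) ∧
        ω ∈ {ω | S₀ ω = s} ∩
          allowed H ((sites s (steps (fun j => ξ j ω) t)).filter fun x => 0 ≤ x 0)}) := by
        refine measure_mono_ae ?_
        filter_upwards [h1.ae_skipFree, h2.start] with ω hω hs he
        obtain ⟨t, ht, ha⟩ := exists_unseparated_of_etaStar hω hs he
        refine Set.mem_iUnion.2 ⟨S₀ ω, t, ht, rfl, fun x => le_trans ?_ (ha x)⟩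
        exact_mod_cast List.filter_sublist.count_le x
    _ ≤ ∑' s, P _ := measure_iUnion_le _
    _ ≤ _ := by
        refine ENNReal.tsum_le_tsum fun s => ?_
        refine (measure_exists_steps_le (Unseparated Set.univ s n) fun l => {ω | S₀ ω = s} ∩
          allowed H ((sites s l).filter fun x => 0 ≤ x 0)).trans_eq ?_
        unfold total
        rw [← ENNReal.tsum_mul_left]
        refine tsum_congr fun l => ?_
        split_ifs
        · rw [Set.inter_left_comm]
          exact measure_start_cost h1 h2 h3 ⟨{s}, trivial, rfl⟩ s l
        · simp

variable [IsProbabilityMeasure P]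

/-- The only place where (A4) and (A5) are used: they supply the loop, a constraint with positive
chance of failing, and the finite mean, each only in the recurrent case that needs it. -/
theorem levelGreen_zero_ne_top (h1 : A1 P ξ) (hH : Measurable (H 0)) (h4 : A4 P ξ H)
    (h5 : P {ω | returnLevel (fun j => ξ j ω) < ⊤} = 1 → 0 < P {ω | H 0 ω < ⊤}) :
    levelGreen (stepLaw P ξ) (tail P H) 0 ≠ ⊤ := by
  refine ne_top_of_le_ne_top ?_ levelGreen_zero_le
  refine tsum_expect_allow_ne_top tail_zero tail_antitone h1.tsum_excursion_le_one ?_ ?_ ?_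
  · exact fun h => h1.exists_loop (h4.return_origin (h1.returnLevel_of_tsum h))
  · exact fun h => exists_tail_lt_one hH (h5 (h1.returnLevel_of_tsum h))
  · exact fun h => tsum_tail_ne_top hH (h4.finite_mean (h1.returnOrigin_of_excursion_zero h))

theorem levelGreen_le_zero (h1 : A1 P ξ) (s : Lattice d) :
    levelGreen (stepLaw P ξ) (tail P H) s ≤ levelGreen (stepLaw P ξ) (tail P H) 0 := by
  classical
  refine (levelGreen_le tail_zero tail_antitone s).trans (mul_le_of_le_one_left' ?_)
  exact h1.tsum_le_one fun l l' h h' => h.prefix_eq h'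

theorem total_firstPassage_le_climb (h1 : A1 P ξ) (h3 : A3 P H) {s : Lattice d} (hs : s 0 ≤ 0)
    (n : ℕ) : total (stepLaw P ξ) (tail P H) s (FirstPassage s n) ≤
      levelGreen (stepLaw P ξ) (tail P H) 0 * climb (stepLaw P ξ) (tail P H) n := by
  refine (total_firstPassage_le h1.stepLaw_skipFree tail_zero h3.tail_one tail_antitone hs n).trans
    ?_
  gcongr
  exact levelGreen_le_zero h1 s

theorem climb_le_one (h1 : A1 P ξ) (n : ℕ) : climb (stepLaw P ξ) (tail P H) n ≤ 1 := by
  classical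
  refine le_trans (ENNReal.tsum_le_tsum fun l => ?_) (h1.tsum_le_one (F := Upward n)
    fun l l' h h' => h.1.prefix_eq h'.1)
  split_ifs
  · exact mul_le_of_le_one_right' (allow_le_one tail_zero tail_antitone _)
  · exact le_rfl

theorem step_le_one (h1 : A1 P ξ) (n : ℕ) : step (stepLaw P ξ) (tail P H) n ≤ 1 :=
  (total_mono fun _ hl => hl.1).trans (climb_le_one h1 n)

theorem climb_one_ne_zero (h1 : A1 P ξ) (h3 : A3 P H) :
    climb (stepLaw P ξ) (tail P H) 1 ≠ 0 := by
  classical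
  obtain ⟨a, ha, hpa⟩ := h1.exists_step_up
  intro h
  have hu : Upward 1 [a] := ⟨⟨by simpa using ha, by simp⟩, by simp⟩
  have := ENNReal.tsum_eq_zero.1 h [a]
  rw [if_pos hu, cost, filter_sites_of_level (by simp) hu] at this
  simp [allow, h3.tail_one, hpa] at this

theorem probKappaZero_eq (h1 : A1 P ξ) (h2 : A2 P S₀ ξ H) (h3 : A3 P H) {n : ℕ} (hn : 0 < n) :
    probKappaZero P ξ H n = (step (stepLaw P ξ) (tail P H) n).toReal := by
  classical
  unfold probKappaZero Measure.real
  congr 1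
  have hae : {ω | kappaStar n (walk 0 fun j => ξ j ω) (zeroBelow fun x => H x ω) = (0 : ℕ)} =ᵐ[P]
      {ω | ∃ t, (Upward n (steps (fun j => ξ j ω) t) ∧
        ∀ j, 0 < j → j < n → ¬ Separates 0 (steps (fun j => ξ j ω) t) j) ∧
        ω ∈ allowed H ((sites 0 (steps (fun j => ξ j ω) t)).filter fun x => 0 ≤ x 0)} := by
    filter_upwards [h1.ae_skipFree, ae_one_le h3] with ω hω hω'
    exact propext (kappaStar_eq_zero_iff hω hω' hn)
  have h := measure_exists_steps (P := P) (ξ := ξ) (F := fun l => Upward n l ∧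
    ∀ j, 0 < j → j < n → ¬ Separates 0 l j)
    (C := fun l => allowed H ((sites 0 l).filter fun x => 0 ≤ x 0))
    (fun l l' h h' => h.1.1.prefix_eq h'.1.1) h1.measurableSet_startsWith
    fun l => h2.measurableSet_allowed _
  refine (measure_congr hae).trans (h.trans ?_)
  unfold step total
  refine tsum_congr fun l => ?_
  have e := measure_start_cost h1 h2 h3 (A := Set.univ) .univ 0 l
  rw [Set.univ_inter, measure_univ, one_mul] at e
  split_ifs
  · exact e
  · rfl

/-- Averages over the starting point the decomposition of first passages at their lowest separating
level, with the bound by N u_n uniform over starts at levels at most 0. -/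
theorem sum_measure_etaStar_le (h1 : A1 P ξ) (h2 : A2 P S₀ ξ H) (h3 : A3 P H) (n : ℕ) :
    ∑ m ∈ Finset.range (n + 1),
      P {ω | etaStar m (walk (S₀ ω) fun j => ξ j ω) (fun x => H x ω) = 0} *
        climb (stepLaw P ξ) (tail P H) (n - m) ≤
      levelGreen (stepLaw P ξ) (tail P H) 0 * climb (stepLaw P ξ) (tail P H) n := by
  have hS : ∑' s, P {ω | S₀ ω = s} ≤ 1 := by
    have : ∑' s, P (S₀ ⁻¹' {s}) = P (⋃ s, S₀ ⁻¹' {s}) := by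
      refine (measure_iUnion ?_ fun s => h2.measurable_start (.singleton s)).symm
      intro s s' hne
      exact Disjoint.preimage _ (Set.disjoint_singleton.2 hne)
    exact this.trans_le prob_le_one
  calc _ ≤ ∑ m ∈ Finset.range (n + 1), ∑' s, P {ω | S₀ ω = s} *
        (total (stepLaw P ξ) (tail P H) s (Unseparated Set.univ s m) *
          climb (stepLaw P ξ) (tail P H) (n - m)) := by
        refine Finset.sum_le_sum fun m _ => ?_
        simp only [← mul_assoc]
        rw [ENNReal.tsum_mul_right]
        gcongr
        exact measure_etaStar_le h1 h2 h3 m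
    _ = ∑' s, P {ω | S₀ ω = s} * ∑ m ∈ Finset.range (n + 1),
        total (stepLaw P ξ) (tail P H) s (Unseparated Set.univ s m) *
          climb (stepLaw P ξ) (tail P H) (n - m) := by
        simp only [Finset.mul_sum]
        exact (Summable.tsum_finsetSum fun _ _ => ENNReal.summable).symm
    _ ≤ ∑' s, P {ω | S₀ ω = s} * (levelGreen (stepLaw P ξ) (tail P H) 0 *
        climb (stepLaw P ξ) (tail P H) n) := by
        refine ENNReal.tsum_le_tsum fun s => ?_
        by_cases hs : s 0 ≤ 0
        · gcongr
          exact (sum_unseparated_le n s).trans (total_firstPassage_le_climb h1 h3 hs n)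
        · have : P {ω | S₀ ω = s} = 0 := by
            refine measure_mono_null (fun ω (hω : S₀ ω = s) => ?_) (ae_iff.1 h2.start)
            rw [Set.mem_ofPred_eq, hω]
            exact hs
          rw [this, zero_mul, zero_mul]
    _ ≤ _ := by
        rw [ENNReal.tsum_mul_right]
        exact mul_le_of_le_one_left' hS

theorem probEtaZero_zero_pos (h1 : A1 P ξ) (h2 : A2 P S₀ ξ H) : 0 < probEtaZero P S₀ ξ H 0 := by
  refine ENNReal.toReal_pos (fun h => h2.reach.ne' ?_) (measure_ne_top _ _)
  rw [← nonpos_iff_eq_zero, ← h]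
  refine measure_mono_ae ?_
  filter_upwards [h1.ae_skipFree, h2.start] with ω hω hs hr
  exact etaStar_zero_of_reaches hω hs hr

theorem sum_probEtaZero_le (h1 : A1 P ξ) (h2 : A2 P S₀ ξ H) (h3 : A3 P H)
    (hN : levelGreen (stepLaw P ξ) (tail P H) 0 ≠ ⊤) (n : ℕ) :
    ∑ m ∈ Finset.range (n + 1), probEtaZero P S₀ ξ H m *
        (climb (stepLaw P ξ) (tail P H) (n - m)).toReal ≤
      (levelGreen (stepLaw P ξ) (tail P H) 0).toReal *
        (climb (stepLaw P ξ) (tail P H) n).toReal := by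
  have hc : ∀ n, climb (stepLaw P ξ) (tail P H) n ≠ ⊤ := fun n =>
    ne_top_of_le_ne_top ENNReal.one_ne_top (climb_le_one h1 n)
  have h := ENNReal.toReal_mono (ENNReal.mul_ne_top hN (hc n)) (sum_measure_etaStar_le h1 h2 h3 n)
  rw [ENNReal.toReal_mul, ENNReal.toReal_sum fun m _ =>
    ENNReal.mul_ne_top (measure_ne_top _ _) (hc _)] at h
  simp only [ENNReal.toReal_mul] at h
  exact h

theorem climb_toReal_succ (h1 : A1 P ξ) (h2 : A2 P S₀ ξ H) (h3 : A3 P H) (n : ℕ) :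
    (climb (stepLaw P ξ) (tail P H) (n + 1)).toReal =
      ∑ k ∈ Finset.range (n + 1), probKappaZero P ξ H (k + 1) *
        (climb (stepLaw P ξ) (tail P H) (n - k)).toReal := by
  rw [climb_succ, ← Finset.Ico_add_one_right_eq_Icc, Finset.sum_Ico_eq_sum_range,
    ENNReal.toReal_sum fun m _ => ENNReal.mul_ne_top
      (ne_top_of_le_ne_top ENNReal.one_ne_top (step_le_one h1 _))
      (ne_top_of_le_ne_top ENNReal.one_ne_top (climb_le_one h1 _))]
  refine Finset.sum_congr rfl fun k _ => ?_
  rw [ENNReal.toReal_mul, probKappaZero_eq h1 h2 h3 (Nat.succ_pos k), add_comm 1 k,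
    Nat.add_sub_add_right]

end LocalConstraints

end

theorem theorem1 {d : ℕ} [NeZero d] {Ω : Type*} [MeasurableSpace Ω]
    (P : Measure Ω) [IsProbabilityMeasure P]
    (S₀ : Ω → LocalConstraints.Lattice d) (ξ : ℕ → Ω → LocalConstraints.Lattice d)
    (H : LocalConstraints.Lattice d → Ω → ℕ∞)
    (h1 : LocalConstraints.A1 P ξ) (h2 : LocalConstraints.A2 P S₀ ξ H)
    (h3 : LocalConstraints.A3 P H) (h4 : LocalConstraints.A4 P ξ H)
    (h5 : P {ω | LocalConstraints.returnLevel (fun j => ξ j ω) < ⊤} = 1 →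
      0 < P {ω | H 0 ω < ⊤}) :
    ∃ q : ℝ, 0 < q ∧ q ≤ 1 ∧
      HasSum (fun k : ℕ => LocalConstraints.probKappaZero P ξ H (k + 1) / q ^ (k + 1)) 1 ∧
      (∃ m : ℝ, 1 ≤ m ∧
        HasSum (fun k : ℕ =>
          ((k + 1 : ℕ) : ℝ) * LocalConstraints.probKappaZero P ξ H (k + 1) / q ^ (k + 1)) m) ∧
      (∃ ψ₀ : ℝ, 0 < ψ₀ ∧
        HasSum (fun n : ℕ => LocalConstraints.probEtaZero P S₀ ξ H n / q ^ n) ψ₀) := by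
  have hN := LocalConstraints.levelGreen_zero_ne_top h1 (h2.measurable_env 0) h4 h5
  set N := LocalConstraints.levelGreen (LocalConstraints.stepLaw P ξ) (LocalConstraints.tail P H) 0
  set u : ℕ → ℝ := fun n =>
    (LocalConstraints.climb (LocalConstraints.stepLaw P ξ) (LocalConstraints.tail P H) n).toReal
    with hu
  have hpos : ∀ n, 0 ≤ LocalConstraints.probEtaZero P S₀ ξ H n := fun n => measureReal_nonneg
  have hfin : ∀ n, LocalConstraints.climb (LocalConstraints.stepLaw P ξ)
      (LocalConstraints.tail P H) n ≠ ⊤ := fun n =>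
    ne_top_of_le_ne_top ENNReal.one_ne_top (LocalConstraints.climb_le_one h1 n)
  have hsub : ∀ a b, u (a + b) ≤ N.toReal * u a * u b := by
    intro a b
    have h := (LocalConstraints.climb_add_le h1.stepLaw_skipFree LocalConstraints.tail_zero
      LocalConstraints.tail_antitone a b).trans (mul_le_mul_right
        (LocalConstraints.total_firstPassage_le_climb h1 h3 le_rfl b) _)
    have h := ENNReal.toReal_mono
      (ENNReal.mul_ne_top (hfin a) (ENNReal.mul_ne_top hN (hfin b))) h
    rw [ENNReal.toReal_mul, ENNReal.toReal_mul] at h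
    calc u (a + b) ≤ u a * (N.toReal * u b) := h
      _ = _ := by ring
  have hle : ∀ n, u n ≤ 1 := by
    intro n
    have h := ENNReal.toReal_mono ENNReal.one_ne_top
      (LocalConstraints.climb_le_one (H := H) h1 n)
    simpa using h
  obtain ⟨q, hq0, hq1, hqu, hqC, hsum, hmean⟩ :=
    LocalConstraints.exists_renewal_rate (u := u)
      (f := LocalConstraints.probKappaZero P ξ H) (C := N.toReal)
      (by simp [hu, LocalConstraints.climb_zero])
      (ENNReal.toReal_pos (LocalConstraints.climb_one_ne_zero h1 h3) (hfin 1))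
      (fun _ => ENNReal.toReal_nonneg)
      hle
      (fun _ => measureReal_nonneg) hsub (LocalConstraints.climb_toReal_succ h1 h2 h3)
  refine ⟨q, hq0, hq1, hsum, hmean, ?_⟩
  -- One factor N comes from 1/q^m = q^(n-m)/q^n ≤ N u(n-m)/q^n, the other from the decomposition at
  -- the lowest separating level; u n ≤ q^n then removes n.
  have hpart : ∀ n, ∑ m ∈ Finset.range n, LocalConstraints.probEtaZero P S₀ ξ H m / q ^ m ≤
      N.toReal * N.toReal := by
    intro n
    calc ∑ m ∈ Finset.range n, LocalConstraints.probEtaZero P S₀ ξ H m / q ^ m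
        ≤ ∑ m ∈ Finset.range (n + 1), LocalConstraints.probEtaZero P S₀ ξ H m / q ^ m := by
          rw [Finset.sum_range_succ]
          exact le_add_of_nonneg_right (div_nonneg (hpos n) (pow_pos hq0 n).le)
      _ ≤ ∑ m ∈ Finset.range (n + 1), LocalConstraints.probEtaZero P S₀ ξ H m *
          (N.toReal * u (n - m)) / q ^ n := by
          refine Finset.sum_le_sum fun m hm => ?_
          have hm : m ≤ n := by simpa [Nat.lt_succ_iff] using hm
          rw [div_le_div_iff₀ (pow_pos hq0 m) (pow_pos hq0 n), mul_assoc]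
          refine mul_le_mul_of_nonneg_left ?_ (hpos m)
          calc q ^ n = q ^ (n - m) * q ^ m := by rw [← pow_add, Nat.sub_add_cancel hm]
            _ ≤ _ := mul_le_mul_of_nonneg_right (hqC _) (pow_pos hq0 m).le
      _ = N.toReal * (∑ m ∈ Finset.range (n + 1), LocalConstraints.probEtaZero P S₀ ξ H m *
          u (n - m)) / q ^ n := by
          rw [Finset.mul_sum, Finset.sum_div]
          exact Finset.sum_congr rfl fun m _ => by ring
      _ ≤ _ := by
          rw [div_le_iff₀ (pow_pos hq0 n), mul_assoc]
          refine mul_le_mul_of_nonneg_left ?_ ENNReal.toReal_nonneg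
          exact (LocalConstraints.sum_probEtaZero_le h1 h2 h3 hN n).trans
            (mul_le_mul_of_nonneg_left (hqu n) ENNReal.toReal_nonneg)
  have hψ : Summable fun n => LocalConstraints.probEtaZero P S₀ ξ H n / q ^ n :=
    summable_of_sum_range_le (fun n => div_nonneg (hpos n) (pow_pos hq0 n).le) hpart
  refine ⟨_, ?_, hψ.hasSum⟩
  refine hψ.tsum_pos (fun n => div_nonneg (hpos n) (pow_pos hq0 n).le) 0 ?_
  simpa using LocalConstraints.probEtaZero_zero_pos h1 h2
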